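/- Let $G$ be a finite group and let $\Sigma$ be a connected CW complex of dimension at most $2$ (Hausdorff, with finitely many edges), whose edges are oriented by their characteristic maps. For each face $p$ let $\partial p=(q_1^{a_1},\dots,q_j^{a_j})$, $a_i=\pm1$, be a closed edge path in the $1$-skeleton that is freely homotopic in the $1$-skeleton to the attaching map of $p$. Let $Y$ be a non-empty finite set of vertices of $\Sigma$ (the ghost vertices), and let $E$ be the set of edges. The rough quantum double code on $(\Sigma,Y)$ has physical space $\mathbb C[G^E]$ with basis $|\mathbf g\rangle$, $\mathbf g\in G^E$. For a vertex $v$ and $h\in G$, the $X$-check $X_v^h$ sends $|\mathbf g\rangle$ to $|\mathbf g'\rangle$, where $\mathbf g'$ is obtained from $\mathbf g$ by multiplying $g_q$ on the left by $h$ for every edge $q$ that leaves $v$ and on the right by $h^{-1}$ for every edge $q$ that enters $v$ (both, if $q$ is a loop at $v$). The $Z$-check of a face $p$ sends $|\mathbf g\rangle$ to $|\mathbf g\rangle$ if $g_{q_1}^{a_1}\cdots g_{q_j}^{a_j}=1$ and to $0$ otherwise. The codespace is $$\mathcal C=\{\psi\in\mathbb C[G^E] : X_v^h\psi=\psi\ \text{for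 all } v\notin Y,\ h\in G,\ \text{and}\ Z_p\psi=\psi\ \text{for all faces } p\}.$$ Let $\Sigma/Y$ be the quotient space in which all points of $Y$ are identified to one point, also denoted $Y$; $\pi_1$ is the topological fundamental group. For a set $S$, $\mathbb C[S]$ is the space of formal finite linear combinations of elements of $S$. Then: 1. $\mathcal C\cong\mathbb C[\mathrm{Hom}(\pi_1(\Sigma/Y,Y),G)]$. More precisely, $\mathcal C$ has a basis $(|\phi\rangle)$ indexed by $\phi\in\mathrm{Hom}(\pi_1(\Sigma/Y,Y),G)$, where $|\phi\rangle=\sum_{\mathbf g}|\mathbf g\rangle$ is the sum over all $\mathbf g\in G^E$ with holonomy $\phi$, that is, such that for every edge path $\gamma=(r_1^{b_1},\dots,r_m^{b_m})$ in $\Sigma$ between two (possibly equal) vertices of $Y$ one has $g_{r_1}^{b_1}\cdots g_{r_m}^{b_m}=\phi([\gamma])$, with $[\gamma]\in\pi_1(\Sigma/Y,Y)$ the class of the image of $\gamma$ in $\Sigma/Y$ (the product in $\pi_1$ being concatenation in order of traversal). 2. $\pi_1(\Sigma/Y,Y)\cong\pi_1(\Sigma,x)*\mathbb Z^{*(|Y|-1)}$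 for every base point $x\in\Sigma$, where $*$ is the free product. 3. $\mathcal C\cong\mathbb C[\mathrm{Hom}(\pi_1(\Sigma,x),G)]\otimes\mathbb C[G^{|Y|-1}]$ for every base point $x\in\Sigma$. -/

import Mathlib

noncomputable section

open Topology

namespace QuantumDouble

universe u v

section Complex

variable (X : Type u) [TopologicalSpace X] [CWComplex (Set.univ : Set X)]

/-- The vertices (0-cells) of the CW complex `X`. -/
abbrev Vertex : Type u := RelCWComplex.cell (Set.univ : Set X) 0

/-- The edges (1-cells) of the CW complex `X`. -/
abbrev Edge : Type u := RelCWComplex.cell (Set.univ : Set X) 1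

/-- The faces, or plaquettes (2-cells), of the CW complex `X`. -/
abbrev Face : Type u := RelCWComplex.cell (Set.univ : Set X) 2

/-- The 1-skeleton of `X`, with the subspace topology. -/
abbrev OneSkeleton [T2Space X] : Type u :=
  {x : X // x ∈ (RelCWComplex.skeleton (Set.univ : Set X) 1 : Set X)}

variable {X}

/-- The point of `X` given by a vertex. -/
def vertexPoint (v : Vertex X) : X := RelCWComplex.map (C := Set.univ) 0 v ![]

theorem exists_vertex (e : Edge X) (c : Fin 1 → ℝ) (hc : ‖c‖ = 1) :
    ∃ v : Vertex X, vertexPoint v = RelCWComplex.map (C := Set.univ) 1 e c := by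
  obtain ⟨I, hI⟩ := CWComplex.cellFrontier_subset_finite_closedCell 1 e
  have hmem : RelCWComplex.map (C := Set.univ) 1 e c ∈ RelCWComplex.cellFrontier 1 e :=
    ⟨c, by simpa using hc, rfl⟩
  have h := hI hmem
  simp only [Order.lt_one_iff, Set.iUnion_iUnion_eq_left, Set.mem_iUnion,
    RelCWComplex.closedCell_zero_eq_singleton, Set.mem_singleton_iff] at h
  obtain ⟨v, -, hv⟩ := h
  exact ⟨v, hv.symm⟩

/-- The initial vertex of an edge. Edges are oriented by their characteristic maps `[-1, 1] → X`. -/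
def source (e : Edge X) : Vertex X :=
  (exists_vertex e (fun _ => -1) (by simp)).choose

/-- The terminal vertex of an edge. -/
def target (e : Edge X) : Vertex X :=
  (exists_vertex e (fun _ => 1) (by simp)).choose

theorem vertexPoint_source (e : Edge X) :
    vertexPoint (source e) = RelCWComplex.map (C := Set.univ) 1 e (fun _ => -1) :=
  (exists_vertex e (fun _ => -1) (by simp)).choose_spec

theorem vertexPoint_target (e : Edge X) :
    vertexPoint (target e) = RelCWComplex.map (C := Set.univ) 1 e (fun _ => 1) :=
  (exists_vertex e (fun _ => 1) (by simp)).choose_spec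

variable (X) in
/-- An edge together with a direction of traversal: `(e, true)` runs along the orientation of `e`,
and `(e, false)` runs against it. -/
abbrev DirectedEdge : Type u := Edge X × Bool

/-- The vertex at which a directed edge starts. -/
def DirectedEdge.start (d : DirectedEdge X) : Vertex X := if d.2 then source d.1 else target d.1

/-- The vertex at which a directed edge ends. -/
def DirectedEdge.finish (d : DirectedEdge X) : Vertex X := if d.2 then target d.1 else source d.1

/-- Edge paths in the 1-skeleton: finite sequences of directed edges, each one starting where
the previous one ends. -/
inductive EdgePath : Vertex X → Vertex X → Type u
  | nil (v : Vertex X) : EdgePath v v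
  | cons (d : DirectedEdge X) {w : Vertex X} (rest : EdgePath d.finish w) : EdgePath d.start w

section Realization

variable [T2Space X]

/-- A vertex as a point of the 1-skeleton. -/
def skeletonPoint (v : Vertex X) : OneSkeleton X :=
  ⟨vertexPoint v,
    RelCWComplex.skeleton_mono (C := (Set.univ : Set X)) (n := (1 : ℕ∞)) (m := ((0 : ℕ) : ℕ∞))
      (by simp)
      (RelCWComplex.closedCell_subset_skeleton 0 v (by
        rw [RelCWComplex.closedCell_zero_eq_singleton]; rfl))⟩

/-- An edge as a path in the 1-skeleton, `t ↦ Φ (2 t - 1)` for the characteristic map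
`Φ : [-1, 1] → X`. -/
def edgeCurve (e : Edge X) : Path (skeletonPoint (source e)) (skeletonPoint (target e)) where
  toFun t := ⟨RelCWComplex.map (C := Set.univ) 1 e (fun _ => 2 * (t : ℝ) - 1),
    RelCWComplex.closedCell_subset_skeleton 1 e ⟨fun _ => 2 * (t : ℝ) - 1, by
      rw [mem_closedBall_zero_iff, pi_norm_le_iff_of_nonneg zero_le_one]
      intro _
      rw [Real.norm_eq_abs, abs_le]
      constructor <;> linarith [t.2.1, t.2.2], rfl⟩⟩
  continuous_toFun := by
    refine Continuous.subtype_mk ?_ _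
    refine (RelCWComplex.continuousOn (C := (Set.univ : Set X)) 1 e).comp_continuous
      (by fun_prop) ?_
    intro t
    rw [mem_closedBall_zero_iff, pi_norm_le_iff_of_nonneg zero_le_one]
    intro _
    rw [Real.norm_eq_abs, abs_le]
    constructor <;> linarith [t.2.1, t.2.2]
  source' := by
    refine Subtype.ext ?_
    refine Eq.trans ?_ (vertexPoint_source e).symm
    simp
  target' := by
    refine Subtype.ext ?_
    refine Eq.trans ?_ (vertexPoint_target e).symm
    norm_num

/-- A directed edge as a path in the 1-skeleton. -/
def DirectedEdge.curve : (d : DirectedEdge X) →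
    Path (skeletonPoint d.start) (skeletonPoint d.finish)
  | (e, true) => edgeCurve e
  | (e, false) => (edgeCurve e).symm

/-- An edge path as a (continuous) path in the 1-skeleton. -/
def EdgePath.curve : {v w : Vertex X} → EdgePath v w → Path (skeletonPoint v) (skeletonPoint w)
  | _, _, .nil v => Path.refl (skeletonPoint v)
  | _, _, .cons d rest => d.curve.trans rest.curve

/-- The point in direction `2 π t` on the unit sphere of the sup norm on `ℝ²`, that is, on the
boundary of the square `[-1, 1]²`, which is the domain of the characteristic map of a face. -/
def squareBoundary (t : ℝ) : Fin 2 → ℝ :=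
  ‖![Real.cos (2 * Real.pi * t), Real.sin (2 * Real.pi * t)]‖⁻¹ •
    ![Real.cos (2 * Real.pi * t), Real.sin (2 * Real.pi * t)]

theorem squareBoundary_ne (t : ℝ) :
    ![Real.cos (2 * Real.pi * t), Real.sin (2 * Real.pi * t)] ≠ 0 := by
  intro h
  have h0 := congrFun h 0
  have h1 := congrFun h 1
  have := Real.cos_sq_add_sin_sq (2 * Real.pi * t)
  simp at h0 h1
  simp [h0, h1] at this

theorem norm_squareBoundary (t : ℝ) : ‖squareBoundary t‖ = 1 := by
  rw [squareBoundary, norm_smul, norm_inv, norm_norm,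
    inv_mul_cancel₀ (norm_ne_zero_iff.mpr (squareBoundary_ne t))]

theorem continuous_squareBoundary : Continuous squareBoundary := by
  have h : Continuous fun t : ℝ =>
      (![Real.cos (2 * Real.pi * t), Real.sin (2 * Real.pi * t)] : Fin 2 → ℝ) := by
    refine continuous_pi fun i => ?_
    fin_cases i
    · simpa using (by fun_prop : Continuous fun t : ℝ => Real.cos (2 * Real.pi * t))
    · simpa using (by fun_prop : Continuous fun t : ℝ => Real.sin (2 * Real.pi * t))
  exact (h.norm.inv₀ fun t => norm_ne_zero_iff.mpr (squareBoundary_ne t)).smul h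

/-- The value of the attaching map of the face `p` in direction `2 π t`. -/
def attachingPoint (p : Face X) (t : ℝ) : OneSkeleton X :=
  ⟨RelCWComplex.map (C := Set.univ) 2 p (squareBoundary t),
    RelCWComplex.cellFrontier_subset_skeleton 1 p
      ⟨squareBoundary t, by simpa using norm_squareBoundary t, rfl⟩⟩

/-- The attaching map of the face `p`, as a loop in the 1-skeleton. -/
def attachingLoop (p : Face X) : Path (attachingPoint p 0) (attachingPoint p 0) where
  toFun t := attachingPoint p t
  continuous_toFun := by
    refine Continuous.subtype_mk ?_ _
    refine (RelCWComplex.continuousOn (C := (Set.univ : Set X)) 2 p).comp_continuous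
      (continuous_squareBoundary.comp continuous_subtype_val) ?_
    intro t
    simpa using (norm_squareBoundary t).le
  source' := rfl
  target' := by
    refine Subtype.ext ?_
    simp [attachingPoint, squareBoundary]

/-- A boundary word of the face `p`: a closed edge path which, as a loop in the 1-skeleton, is
freely homotopic to the attaching map of `p`, that is, homotopic to it up to a change of base point
along some path `σ` of the 1-skeleton. -/
structure BoundaryWord (p : Face X) where
  /-- The vertex where the closed edge path begins and ends. -/
  base : Vertex X
  /-- The closed edge path. -/
  path : EdgePath base base
  /-- The edge path represents the attaching map. -/
  homotopic : ∃ σ : Path (attachingPoint p 0) (skeletonPoint base),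
    (attachingLoop p).Homotopic ((σ.trans path.curve).trans σ.symm)

end Realization

end Complex

section Code

variable {X : Type u} [TopologicalSpace X] [CWComplex (Set.univ : Set X)] (G : Type v) [Group G]

variable (X) in
/-- A configuration (a `G`-valued connection) assigns an element of `G` to each edge: the labels
of the computational basis states of the `G`-qudits on the edges. -/
abbrev Configuration : Type (max u v) := Edge X → G

variable (X) in
/-- The physical Hilbert space `ℂ[G^n]`, spanned by the basis states
`|a⟩ = Finsupp.single a 1`. -/
abbrev PhysicalSpace : Type (max u v) := Configuration X G →₀ ℂ

variable {G}

/-- The group element carried by a directed edge: `a e` along the orientation of `e`, and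
`(a e)⁻¹` against it. -/
def DirectedEdge.value (a : Configuration X G) (d : DirectedEdge X) : G :=
  if d.2 then a d.1 else (a d.1)⁻¹

/-- The holonomy of a configuration along an edge path: the product, in order, of the group elements
of its directed edges. -/
def EdgePath.holonomy (a : Configuration X G) : {v w : Vertex X} → EdgePath v w → G
  | _, _, .nil _ => 1
  | _, _, .cons d rest => d.value a * rest.holonomy a

open Classical in
/-- The gauge transformation by `g` at the vertex `v`: the group element of an edge is multiplied
by `g` on the left if the edge leaves `v` and by `g⁻¹` on the right if it enters `v` (both,
if it is a loop at `v`). -/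
def gaugeTransform (v : Vertex X) (g : G) (a : Configuration X G) : Configuration X G :=
  fun e => (if source e = v then g else 1) * a e * (if target e = v then g⁻¹ else 1)

/-- The `X`-check of `g` at the vertex `v`. -/
def xCheck (v : Vertex X) (g : G) : Module.End ℂ (PhysicalSpace X G) :=
  Finsupp.lmapDomain ℂ ℂ (gaugeTransform v g)

open Classical in
/-- The `Z`-check of a closed edge path `γ`: the projection onto the basis states with trivial
holonomy along `γ`. -/
def zCheck {v : Vertex X} (γ : EdgePath v v) : Module.End ℂ (PhysicalSpace X G) :=
  Finsupp.linearCombination ℂ fun a : Configuration X G =>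
    if γ.holonomy a = 1 then Finsupp.single a (1 : ℂ) else 0

variable (G) in
/-- The codespace of the rough quantum double with ghost vertices `Y`: the joint `+1`-eigenspace of
the `X`-checks at all vertices that are not ghost vertices and of the `Z`-checks of all faces. -/
def codespace [T2Space X] (bdry : ∀ p : Face X, BoundaryWord p) (Y : Set (Vertex X)) :
    Submodule ℂ (PhysicalSpace X G) :=
  (⨅ v ∈ Yᶜ, ⨅ g : G, Module.End.eigenspace (xCheck v g) 1) ⊓
    ⨅ p : Face X, Module.End.eigenspace (zCheck (bdry p).path) 1

end Code

section Quotient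

variable {X : Type u} [TopologicalSpace X] [CWComplex (Set.univ : Set X)]

/-- The equivalence relation on `X` that identifies all ghost vertices and nothing else. -/
def ghostSetoid (Y : Set (Vertex X)) : Setoid X where
  r x x' := x = x' ∨ (x ∈ vertexPoint '' Y ∧ x' ∈ vertexPoint '' Y)
  iseqv :=
    { refl := fun _ => Or.inl rfl
      symm := by
        rintro _ _ (rfl | ⟨h, h'⟩)
        · exact Or.inl rfl
        · exact Or.inr ⟨h', h⟩
      trans := by
        rintro _ _ _ (rfl | ⟨h, h'⟩) (rfl | ⟨k, k'⟩)
        · exact Or.inl rfl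
        · exact Or.inr ⟨k, k'⟩
        · exact Or.inr ⟨h, h'⟩
        · exact Or.inr ⟨h, k'⟩ }

/-- The space `X / Y`, with the quotient topology. -/
abbrev GhostQuotient (Y : Set (Vertex X)) : Type u := Quotient (ghostSetoid Y)

/-- The image of a vertex in `X / Y`. -/
def ghostPoint (Y : Set (Vertex X)) (v : Vertex X) : GhostQuotient Y :=
  Quotient.mk (ghostSetoid Y) (vertexPoint v)

theorem ghostPoint_eq {Y : Set (Vertex X)} {v w : Vertex X} (hv : v ∈ Y) (hw : w ∈ Y) :
    ghostPoint Y v = ghostPoint Y w :=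
  Quotient.sound (Or.inr ⟨⟨v, hv, rfl⟩, ⟨w, hw, rfl⟩⟩)

variable [T2Space X]

/-- An edge path between two ghost vertices becomes a loop in `X / Y`, based at the common image of
the ghost vertices. -/
def ghostLoop {Y : Set (Vertex X)} {y v w : Vertex X} (hy : y ∈ Y) (hv : v ∈ Y) (hw : w ∈ Y)
    (γ : EdgePath v w) : Path (ghostPoint Y y) (ghostPoint Y y) :=
  (γ.curve.map (f := fun x : OneSkeleton X => Quotient.mk (ghostSetoid Y) x.1)
    (continuous_quotient_mk'.comp continuous_subtype_val)).cast
      (ghostPoint_eq hy hv) (ghostPoint_eq hy hw)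

/-- The configuration `a` has holonomy `φ : π₁(X / Y) → G`: for every edge path between ghost
vertices, the product of the group elements along it is the value of `φ` at the resulting
loop in `X / Y`. (The product `p * q` of `FundamentalGroup` runs through `q` first, whereas the
holonomy multiplies in the order of traversal; the inverse passes from one convention to
the other.) -/
def HasHolonomy {G : Type v} [Group G] {Y : Set (Vertex X)} {y : Vertex X} (hy : y ∈ Y)
    (φ : FundamentalGroup (GhostQuotient Y) (ghostPoint Y y) →* G)
    (a : Configuration X G) : Prop :=
  ∀ (v w : Vertex X) (hv : v ∈ Y) (hw : w ∈ Y) (γ : EdgePath v w),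
    γ.holonomy a = φ (FundamentalGroup.fromPath ⟦ghostLoop hy hv hw γ⟧)⁻¹

end Quotient

end QuantumDouble

end

/-! Call a configuration flat if its holonomy along every boundary word is trivial. By
`mem_codespace_iff`, a code vector is a function on `G^E` which is supported on the flat
configurations and invariant under gauge transformations at the vertices outside `Y`. The basis
therefore exists once four facts are known: the flat configurations are exactly those with a
holonomy `φ` (`exists_hasHolonomy_iff`), `φ` is then unique (`HasHolonomy.unique`), every `φ` occurs
(`exists_hasHolonomy`), and configurations with the same `φ` differ by a gauge transformation that
is trivial on `Y` (`exists_gauge_of_holonomy_eq`, `eq_of_gauge`).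

The link with topology is a `Transport`, a functor from the fundamental groupoid to a group. A
transport on `X / Y` gives both a configuration, by its values on the edges, and a homomorphism from
the fundamental group. Two results about 2-dimensional cell structures carry the proof and take the
place of van Kampen's theorem. Existence, `CellStructure.exists_transport`: labels of the edges that
are trivial around the faces extend to a transport, namely the monodromy of a covering glued from an
explicit cocycle. Uniqueness, `CellStructure.gaugeRelated_of_edge`: transports that are gauge
equivalent along the edges are so along all paths between vertices, because every path is cut into
pieces that can be pushed along the cells to places where the relation is known.

Both results hold for an arbitrary target group. For the free product decomposition the target is
the free product itself: an edge is labelled by its class in the fundamental group of `X`, twisted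
by the free generators of the ghost vertices at its ends. The resulting transport on `X / Y` gives
one homomorphism; the other sends the generator of a ghost vertex to the inverse of a loop which is
the image of a chosen path in `X`. Uniqueness of transports shows that they are mutually inverse.
The tensor decomposition then follows from the universal properties of free products and free
groups. -/

noncomputable section

open Topology unitInterval

namespace QuantumDouble

/-! ### Functors from the fundamental groupoid to a group -/

section Transport

variable {Z : Type*} [TopologicalSpace Z] {H : Type*} [Group H]

/-- A transport on `Z` with values in the group `H`: a functor from the fundamental groupoid of `Z`
to `H`, which multiplies in the order of traversal. -/
structure Transport (Z : Type*) [TopologicalSpace Z] (H : Type*) [Group H] where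
  /-- The value on a homotopy class of paths. -/
  toFun : ∀ {x y : Z}, Path.Homotopic.Quotient x y → H
  map_trans : ∀ {x y z : Z} (p : Path.Homotopic.Quotient x y) (q : Path.Homotopic.Quotient y z),
    toFun (p.trans q) = toFun p * toFun q

theorem pathClass_refl_trans {x y : Z} (p : Path.Homotopic.Quotient x y) :
    (Path.Homotopic.Quotient.refl x).trans p = p :=
  CategoryTheory.Category.id_comp (X := FundamentalGroupoid.mk x) (Y := FundamentalGroupoid.mk y) p

theorem pathClass_trans_refl {x y : Z} (p : Path.Homotopic.Quotient x y) :
    p.trans (Path.Homotopic.Quotient.refl y) = p :=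
  CategoryTheory.Category.comp_id (X := FundamentalGroupoid.mk x) (Y := FundamentalGroupoid.mk y) p

theorem pathClass_trans_assoc {x y z w : Z} (p : Path.Homotopic.Quotient x y)
    (q : Path.Homotopic.Quotient y z) (r : Path.Homotopic.Quotient z w) :
    (p.trans q).trans r = p.trans (q.trans r) :=
  CategoryTheory.Category.assoc (W := FundamentalGroupoid.mk x) (X := FundamentalGroupoid.mk y)
    (Y := FundamentalGroupoid.mk z) (Z := FundamentalGroupoid.mk w) p q r

theorem pathClass_trans_symm {x y : Z} (p : Path.Homotopic.Quotient x y) :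
    p.trans p.symm = Path.Homotopic.Quotient.refl x :=
  CategoryTheory.Groupoid.comp_inv (X := FundamentalGroupoid.mk x) (Y := FundamentalGroupoid.mk y) p

theorem pathClass_symm_trans {x y : Z} (p : Path.Homotopic.Quotient x y) :
    p.symm.trans p = Path.Homotopic.Quotient.refl y :=
  CategoryTheory.Groupoid.inv_comp (X := FundamentalGroupoid.mk x) (Y := FundamentalGroupoid.mk y) p

/-- The homotopy class of the image of a path between two points of a simply connected space. -/
def arcClass {A : Type*} [TopologicalSpace A] [SimplyConnectedSpace A] (F : C(A, Z)) (a b : A) :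
    Path.Homotopic.Quotient (F a) (F b) :=
  (Path.Homotopic.Quotient.mk (PathConnectedSpace.somePath a b)).map F

/-- Path classes with given ends in a simply connected space form a subsingleton, so any path may
replace the arbitrary one in `arcClass`. -/
theorem mk_map_eq_arcClass {A : Type*} [TopologicalSpace A] [SimplyConnectedSpace A] (F : C(A, Z))
    {a b : A} (p : Path.Homotopic.Quotient a b) : p.map F = arcClass F a b := by
  rw [arcClass, Subsingleton.elim p]

theorem arcClass_trans {A : Type*} [TopologicalSpace A] [SimplyConnectedSpace A] (F : C(A, Z))
    (a b c : A) : (arcClass F a b).trans (arcClass F b c) = arcClass F a c := by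
  rw [← mk_map_eq_arcClass F ((Path.Homotopic.Quotient.mk (PathConnectedSpace.somePath a b)).trans
    (Path.Homotopic.Quotient.mk (PathConnectedSpace.somePath b c)))]
  rw [arcClass, arcClass, ← Path.Homotopic.Quotient.mk_trans, ← Path.Homotopic.Quotient.mk_map,
    ← Path.Homotopic.Quotient.mk_map, ← Path.Homotopic.Quotient.mk_map, Path.map_trans,
    Path.Homotopic.Quotient.mk_trans]

instance : ContractibleSpace I := (convex_Icc (0 : ℝ) 1).contractibleSpace ⟨0, by simp⟩

instance : SimplyConnectedSpace I := SimplyConnectedSpace.ofContractible I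

instance : SimplyConnectedSpace (I × I) := SimplyConnectedSpace.ofContractible (I × I)

namespace Transport

variable (T : Transport Z H)

theorem map_refl (x : Z) : T.toFun (Path.Homotopic.Quotient.refl x) = 1 := by
  have := T.map_trans (Path.Homotopic.Quotient.refl x) (Path.Homotopic.Quotient.refl x)
  rw [pathClass_refl_trans] at this
  simpa using this

theorem map_symm {x y : Z} (p : Path.Homotopic.Quotient x y) : T.toFun p.symm = (T.toFun p)⁻¹ := by
  rw [eq_inv_iff_mul_eq_one, ← T.map_trans, pathClass_symm_trans, map_refl]

theorem map_cast {x y x' y' : Z} (p : Path.Homotopic.Quotient x y) (hx : x' = x) (hy : y' = y) :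
    T.toFun (p.cast hx hy) = T.toFun p := by
  subst hx hy; simp

/-- The value of a transport on the image of a path from `a` to `b` in a simply connected
space. -/
def arc {A : Type*} [TopologicalSpace A] [SimplyConnectedSpace A] (F : C(A, Z)) (a b : A) : H :=
  T.toFun (arcClass F a b)

section

variable {A B : Type*} [TopologicalSpace A] [SimplyConnectedSpace A] [TopologicalSpace B]
  [SimplyConnectedSpace B]

theorem arc_mul (F : C(A, Z)) (a b c : A) : T.arc F a b * T.arc F b c = T.arc F a c := by
  rw [arc, arc, ← T.map_trans, arcClass_trans, arc]

theorem arc_self (F : C(A, Z)) (a : A) : T.arc F a a = 1 := by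
  simpa using T.arc_mul F a a a

theorem arc_inv (F : C(A, Z)) (a b : A) : (T.arc F a b)⁻¹ = T.arc F b a := by
  rw [inv_eq_iff_mul_eq_one, arc_mul, arc_self]

theorem arc_comp (F : C(A, Z)) (g : C(B, A)) (a b : B) :
    T.arc (F.comp g) a b = T.arc F (g a) (g b) := by
  rw [arc, arcClass, Path.Homotopic.Quotient.map_comp, mk_map_eq_arcClass, arc]

theorem toFun_mk {x y : Z} (p : Path x y) :
    T.toFun (Path.Homotopic.Quotient.mk p) = T.arc p.toContinuousMap 0 1 := by
  obtain ⟨f, rfl, rfl⟩ := p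
  rw [arc, ← mk_map_eq_arcClass f (Path.Homotopic.Quotient.mk (⟨.id _, rfl, rfl⟩ : Path (0 : I) 1)),
    ← Path.Homotopic.Quotient.mk_map]
  rfl

theorem arc_const (z : Z) (a b : A) : T.arc (ContinuousMap.const A z) a b = 1 := by
  have h : ContinuousMap.const A z = (ContinuousMap.const I z).comp (ContinuousMap.const A 0) := rfl
  rw [h, arc_comp]
  exact T.arc_self _ 0

end

/-- The composition of a transport with a group homomorphism. -/
def mapHom {K : Type*} [Group K] (f : H →* K) : Transport Z K where
  toFun p := f (T.toFun p)
  map_trans p q := by rw [T.map_trans, map_mul]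

/-- The pullback of a transport along a continuous map. -/
def comap {W : Type*} [TopologicalSpace W] (g : C(W, Z)) : Transport W H where
  toFun p := T.toFun (p.map g)
  map_trans p q := by
    induction p using Path.Homotopic.Quotient.ind with | mk p => ?_
    induction q using Path.Homotopic.Quotient.ind with | mk q => ?_
    rw [← T.map_trans, ← Path.Homotopic.Quotient.mk_trans, ← Path.Homotopic.Quotient.mk_map,
      ← Path.Homotopic.Quotient.mk_map, ← Path.Homotopic.Quotient.mk_map, Path.map_trans,
      Path.Homotopic.Quotient.mk_trans]

theorem comap_arc {W : Type*} [TopologicalSpace W] (g : C(W, Z)) {A : Type*} [TopologicalSpace A]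
    [SimplyConnectedSpace A] (F : C(A, W)) (a b : A) :
    (T.comap g).arc F a b = T.arc (g.comp F) a b := by
  rw [arc, arc, arcClass, arcClass, Path.Homotopic.Quotient.map_comp]
  rfl

/-- The homomorphism on the fundamental group given by a transport. -/
def toHom (z : Z) : FundamentalGroup Z z →* H where
  -- The inverse passes from the order of traversal to the product of `FundamentalGroup`, which runs
  -- through its second factor first.
  toFun p := (T.toFun (FundamentalGroup.toPath p))⁻¹
  map_one' := by
    rw [inv_eq_one]
    exact T.map_refl z
  map_mul' p q := by
    rw [← mul_inv_rev]
    exact congrArg _ (T.map_trans _ _)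

theorem toHom_apply (z : Z) (p : FundamentalGroup Z z) :
    T.toHom z p = (T.toFun (FundamentalGroup.toPath p))⁻¹ := rfl

end Transport

/-- The transport with values in the fundamental group that is given by a choice of paths from the
base point to all points. -/
def tautologicalTransport {z : Z} (c : ∀ w : Z, Path.Homotopic.Quotient z w) :
    Transport Z (FundamentalGroup Z z) where
  toFun {x y} p := (FundamentalGroup.fromPath (((c x).trans p).trans (c y).symm))⁻¹
  map_trans {x y w} p q := by
    rw [← mul_inv_rev, FundamentalGroup.mul_def]
    congr 1
    change ((c x).trans (p.trans q)).trans (c w).symm =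
      (((c x).trans p).trans (c y).symm).trans (((c y).trans q).trans (c w).symm)
    rw [pathClass_trans_assoc ((c x).trans p), ← pathClass_trans_assoc (c y).symm,
      ← pathClass_trans_assoc (c y).symm, pathClass_symm_trans, pathClass_refl_trans]
    simp only [pathClass_trans_assoc]

theorem tautologicalTransport_apply_loop {z : Z} {c : ∀ w : Z, Path.Homotopic.Quotient z w}
    (hc : c z = Path.Homotopic.Quotient.refl z) (p : Path.Homotopic.Quotient z z) :
    (tautologicalTransport c).toFun p = (FundamentalGroup.fromPath p)⁻¹ := by
  have h : ((c z).trans p).trans (c z).symm = p := by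
    have : (Path.Homotopic.Quotient.refl z).symm = Path.Homotopic.Quotient.refl z := by
      simpa [pathClass_trans_refl] using
        pathClass_symm_trans (Path.Homotopic.Quotient.refl z)
    rw [hc, pathClass_refl_trans, this, pathClass_trans_refl]
  change (FundamentalGroup.fromPath (((c z).trans p).trans (c z).symm))⁻¹ = _
  rw [h]

theorem tautologicalTransport_apply_choice {z : Z} {c : ∀ w : Z, Path.Homotopic.Quotient z w}
    (hc : c z = Path.Homotopic.Quotient.refl z) (w : Z) :
    (tautologicalTransport c).toFun (c w) = 1 := by
  change (FundamentalGroup.fromPath (((c z).trans (c w)).trans (c w).symm))⁻¹ = _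
  rw [hc, pathClass_refl_trans, pathClass_trans_symm]
  exact inv_one

end Transport

/-! ### Coverings glued from cocycles, and their monodromy -/

section Cocycle

variable {Z : Type*} [TopologicalSpace Z] {H : Type*} [Group H]

/-- An open cover of `Z` together with functions to `H` which differ on the overlaps by locally
constant right factors. -/
structure Cocycle (ι : Type*) (Z : Type*) [TopologicalSpace Z] (H : Type*) [Group H] where
  /-- The members of the cover. -/
  baseSet : ι → Set Z
  /-- The coordinate functions. -/
  coord : ι → Z → H
  exists_mem : ∀ z, ∃ i, z ∈ baseSet i
  isOpen_coord : ∀ i j c, IsOpen {z | z ∈ baseSet i ∧ z ∈ baseSet j ∧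
    (coord i z)⁻¹ * coord j z = c}

namespace Cocycle

variable {ι : Type*} (C : Cocycle ι Z H)

theorem isOpen_baseSet (i : ι) : IsOpen (C.baseSet i) := by
  simpa using C.isOpen_coord i i 1

section Bundle

variable [TopologicalSpace H] [DiscreteTopology H]

/-- The bundle of a cocycle. -/
def core : FiberBundleCore ι Z H where
  baseSet := C.baseSet
  isOpen_baseSet := C.isOpen_baseSet
  indexAt z := (C.exists_mem z).choose
  mem_baseSet_at z := (C.exists_mem z).choose_spec
  -- The factor is chosen so that `C.coord i z * v` is the same in all charts; this is the (in
  -- general discontinuous) `globalCoord`.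
  coordChange i j z v := (C.coord j z)⁻¹ * C.coord i z * v
  coordChange_self i z _ v := by simp
  coordChange_comp i j k z _ v := by
    group
  continuousOn_coordChange i j := by
    rw [continuousOn_open_iff (((C.isOpen_baseSet i).inter (C.isOpen_baseSet j)).prod isOpen_univ)]
    intro t _
    -- The transition factor is locally constant and the fibre is discrete, so the preimage is a
    -- union of open slices on which both are fixed.
    have h : ((C.baseSet i ∩ C.baseSet j) ×ˢ (Set.univ : Set H)) ∩
        (fun p : Z × H => (((C.coord j p.1)⁻¹ * C.coord i p.1 : H) * (p.2 : H) : H)) ⁻¹' t =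
        ⋃ (c : H) (v : H) (_ : (c * v : H) ∈ (t : Set H)),
          {z | z ∈ C.baseSet j ∧ z ∈ C.baseSet i ∧ (C.coord j z)⁻¹ * C.coord i z = c} ×ˢ
            ({v} : Set H) := by
      ext ⟨z, v⟩
      simp only [Set.mem_inter_iff, Set.mem_prod, Set.mem_univ, and_true, Set.mem_preimage,
        Set.mem_iUnion, Set.mem_ofPred_eq, Set.mem_singleton_iff, exists_prop]
      constructor
      · rintro ⟨⟨h1, h2⟩, h3⟩
        exact ⟨_, v, h3, ⟨h2, h1, rfl⟩, rfl⟩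
      · rintro ⟨c, w, h3, ⟨h1, h2, rfl⟩, rfl⟩
        exact ⟨⟨h2, h1⟩, h3⟩
    refine h ▸ ?_
    exact isOpen_iUnion fun c => isOpen_iUnion fun v => isOpen_iUnion fun _ =>
      (C.isOpen_coord j i c).prod (isOpen_discrete _)

theorem isCoveringMap : IsCoveringMap C.core.proj :=
  FiberBundle.isCoveringMap (F := H) (E := C.core.Fiber)

/-- The global coordinate on the bundle of a cocycle. -/
def globalCoord (e : C.core.TotalSpace) : H := C.coord (C.core.indexAt e.1) e.1 * (show H from e.2)

/-- The point of the bundle with given global coordinate. -/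
def point (z : Z) (u : H) : C.core.TotalSpace :=
  ⟨z, (C.coord (C.core.indexAt z) z)⁻¹ * u⟩

theorem globalCoord_point (z : Z) (u : H) : C.globalCoord (C.point z u) = u :=
  mul_inv_cancel_left (C.coord (C.core.indexAt z) z) u

theorem point_globalCoord (e : C.core.TotalSpace) : C.point e.1 (C.globalCoord e) = e := by
  obtain ⟨z, v⟩ := e
  exact congrArg (Bundle.TotalSpace.mk z)
    (inv_mul_cancel_left (C.coord (C.core.indexAt z) z) (v : H))

/-- Right multiplication on the bundle of a cocycle. -/
def rightMul (h : H) (e : C.core.TotalSpace) : C.core.TotalSpace :=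
  ⟨e.1, (show H from e.2) * h⟩

theorem rightMul_point (z : Z) (u h : H) :
    C.rightMul h (C.point z u) = C.point z (u * h) :=
  congrArg (Bundle.TotalSpace.mk z) (mul_assoc (C.coord (C.core.indexAt z) z)⁻¹ u h)

theorem continuous_rightMul (h : H) : Continuous (C.rightMul h) := by
  rw [continuous_iff_continuousAt]
  intro e
  rw [FiberBundle.continuousAt_totalSpace]
  refine ⟨C.core.continuous_proj.continuousAt, ?_⟩
  have h1 : ContinuousAt (fun e' => (C.core.localTrivAt e.1 e').2) e :=
    ((FiberBundle.continuousAt_totalSpace H (fun e' : C.core.TotalSpace => e')).1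
      continuousAt_id).2
  have h2 : Continuous fun v : H => v * h := continuous_of_discreteTopology
  refine (h2.continuousAt.comp h1).congr (Filter.Eventually.of_forall fun e' => ?_)
  exact mul_assoc _ (show H from e'.2) h

/-- The point with global coordinate `u`, as an element of the fibre. -/
def fibrePoint (z : Z) (u : H) : C.core.proj ⁻¹' {z} := ⟨C.point z u, rfl⟩

theorem eq_fibrePoint {z : Z} (e : C.core.proj ⁻¹' {z}) :
    e = C.fibrePoint z (C.globalCoord e) := by
  obtain ⟨e, rfl⟩ := e
  exact Subtype.ext (C.point_globalCoord e).symm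

theorem monodromy_mk {x y : Z} (p : Path x y) (u : H) (Γ : C(I, C.core.TotalSpace))
    (hΓ : ∀ t, (Γ t).1 = p t) (h0 : Γ 0 = C.point x u) :
    (C.isCoveringMap.monodromy (Path.Homotopic.Quotient.mk p) (C.fibrePoint x u)).1 = Γ 1 := by
  have h : (⟨Γ, rfl, rfl⟩ : Path (Γ 0) (Γ 1)).toContinuousMap = Γ := rfl
  have : Γ = C.isCoveringMap.liftPath p.toContinuousMap (C.point x u) p.source :=
    (C.isCoveringMap.eq_liftPath_iff' _).2 ⟨funext hΓ, h0⟩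
  rw [this]
  rfl

/-- Right multiplication is continuous and preserves the fibres, hence carries lifts of a path to
lifts of the same path; monodromy therefore commutes with it. -/
theorem monodromy_fibrePoint {x y : Z} (p : Path.Homotopic.Quotient x y) (u : H) :
    C.globalCoord (C.isCoveringMap.monodromy p (C.fibrePoint x u)) =
      C.globalCoord (C.isCoveringMap.monodromy p (C.fibrePoint x 1)) * u := by
  induction p using Path.Homotopic.Quotient.ind with | mk p => ?_
  let Γ : C(I, C.core.TotalSpace) :=
    C.isCoveringMap.liftPath p.toContinuousMap (C.point x 1) p.source
  have hΓ : ∀ t, (Γ t).1 = p t := congrFun (C.isCoveringMap.liftPath_lifts _ _ p.source)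
  have h0 : Γ 0 = C.point x 1 := C.isCoveringMap.liftPath_zero ..
  rw [C.monodromy_mk p 1 Γ hΓ h0,
    C.monodromy_mk p u (ContinuousMap.comp ⟨C.rightMul u, C.continuous_rightMul u⟩ Γ) hΓ]
  · exact (mul_assoc (C.coord _ _) (show H from (Γ 1).2) u).symm
  · change C.rightMul u (Γ 0) = _
    rw [h0, rightMul_point, one_mul]

/-- The parallel transport of a cocycle. -/
def transport : Transport Z H where
  -- The coordinates of successive paths multiply from right to left, which the inverse corrects.
  toFun {x _} p := (C.globalCoord (C.isCoveringMap.monodromy p (C.fibrePoint x 1)))⁻¹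
  map_trans {x y z} p q := by
    have h := C.eq_fibrePoint (C.isCoveringMap.monodromy p (C.fibrePoint x 1))
    rw [← mul_inv_rev, C.isCoveringMap.monodromy_trans_apply, ← C.monodromy_fibrePoint q, ← h]

/-- Inside one chart the lift is constant in the fibre coordinate. The constant `v` makes it start
at global coordinate `1`, and it ends at `C.coord i (δ 1) * v`. -/
theorem transport_arc (i : ι) (δ : C(I, Z)) (hδ : ∀ t, δ t ∈ C.baseSet i) :
    C.transport.arc δ 0 1 = C.coord i (δ 0) * (C.coord i (δ 1))⁻¹ := by
  let p : Path (δ 0) (δ 1) := ⟨δ, rfl, rfl⟩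
  have hp : C.transport.arc δ 0 1 = C.transport.toFun (Path.Homotopic.Quotient.mk p) :=
    (C.transport.toFun_mk p).symm
  let v : H := ((C.coord i (δ 0))⁻¹ : H)
  let Γ : C(I, C.core.TotalSpace) := ⟨fun t => (C.core.localTriv i).toOpenPartialHomeomorph.symm
    (δ t, v), by
      refine (C.core.localTriv i).toOpenPartialHomeomorph.continuousOn_symm.comp_continuous
        (by fun_prop) fun t => ?_
      exact (C.core.mem_localTriv_target i _).2 (hδ t)⟩
  have hΓ : ∀ t, Γ t = C.point (δ t) (C.coord i (δ t) * (C.coord i (δ 0))⁻¹) := by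
    intro t
    refine (C.core.localTriv_symm_apply i _).trans ?_
    exact congrArg (Bundle.TotalSpace.mk (δ t)) (mul_assoc (C.coord _ (δ t))⁻¹ _ _)
  rw [hp]
  change (C.globalCoord (C.isCoveringMap.monodromy _ (C.fibrePoint (δ 0) 1)))⁻¹ = _
  rw [C.monodromy_mk p 1 Γ (fun t => by rw [hΓ]; rfl) (by rw [hΓ, mul_inv_cancel]), hΓ,
    globalCoord_point, mul_inv_rev, inv_inv]

end Bundle

theorem exists_transport : ∃ T : Transport Z H, ∀ (i : ι) (δ : C(I, Z)),
    (∀ t, δ t ∈ C.baseSet i) → T.arc δ 0 1 = C.coord i (δ 0) * (C.coord i (δ 1))⁻¹ := by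
  let _ : TopologicalSpace H := ⊥
  have : DiscreteTopology H := ⟨rfl⟩
  exact ⟨C.transport, C.transport_arc⟩

end Cocycle

end Cocycle

/-! ### Local-to-global arguments on the unit interval -/

section Interval

/-- The path `t ↦ (1 - t) a + t b` in the unit interval. -/
def segmentMap (a b : I) : C(I, I) :=
  ⟨Set.Icc.convexComb a b, Set.Icc.continuous_convexComb_prod.comp
    (continuous_const.prodMk (continuous_const.prodMk continuous_id))⟩

theorem segmentMap_zero (a b : I) : segmentMap a b 0 = a := Set.Icc.convexComb_zero a b

theorem segmentMap_one (a b : I) : segmentMap a b 1 = b := Set.Icc.convexComb_one a b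

theorem segmentMap_mem (a b t : I) : segmentMap a b t ∈ Set.uIcc a b :=
  Path.range_subpathAux a b ▸ Set.mem_range_self t

theorem exists_nhds_joined {O : Set I} (hO : IsOpen O) {s : I} (hs : s ∈ O) :
    ∃ J ∈ 𝓝 s, ∀ a ∈ J, ∀ b ∈ J, ∃ γ : C(I, I), γ 0 = a ∧ γ 1 = b ∧ ∀ t, γ t ∈ O := by
  obtain ⟨ε, hε, h⟩ := Metric.isOpen_iff.1 hO s hs
  refine ⟨Metric.ball s ε, Metric.ball_mem_nhds s hε, fun a ha b hb =>
    ⟨segmentMap a b, segmentMap_zero a b, segmentMap_one a b, fun t => h ?_⟩⟩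
  have := convex_ball (s : ℝ) ε (show (a : ℝ) ∈ _ from ha) (show (b : ℝ) ∈ _ from hb)
    (unitInterval.one_minus_nonneg t) (unitInterval.nonneg t) (by ring)
  exact this

/-- The points related to `0` form a clopen set, which is not empty because the local hypothesis at
`0` gives `R 0 0`. -/
theorem rel_zero_one_of_local (R : I → I → Prop) (htrans : ∀ a b c, R a b → R b c → R a c)
    (hloc : ∀ s, ∃ J ∈ 𝓝 s, ∀ a ∈ J, ∀ b ∈ J, R a b) : R 0 1 := by
  have hclopen : IsClopen {s | R 0 s} := by
    constructor
    · rw [← isOpen_compl_iff, isOpen_iff_mem_nhds]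
      intro s hs
      obtain ⟨J, hJ, h⟩ := hloc s
      filter_upwards [hJ] with b hb hR
      exact hs (htrans _ _ _ hR (h b hb s (mem_of_mem_nhds hJ)))
    · rw [isOpen_iff_mem_nhds]
      intro s hs
      obtain ⟨J, hJ, h⟩ := hloc s
      filter_upwards [hJ] with b hb
      exact htrans _ _ _ hs (h s (mem_of_mem_nhds hJ) b hb)
  obtain ⟨J, hJ, h⟩ := hloc 0
  have h0 := mem_of_mem_nhds hJ
  have := hclopen.eq_univ ⟨0, h 0 h0 0 h0⟩
  exact Set.eq_univ_iff_forall.1 this 1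

theorem rel_zero_one_of_cover (R : I → I → Prop) (htrans : ∀ a b c, R a b → R b c → R a c) {ι : Type*} (U : ι → Set I)
    (hU : ∀ i, IsOpen (U i)) (hcover : ∀ s, ∃ i, s ∈ U i)
    (h : ∀ i (γ : C(I, I)), (∀ t, γ t ∈ U i) → R (γ 0) (γ 1)) : R 0 1 := by
  refine rel_zero_one_of_local R htrans fun s => ?_
  obtain ⟨i, hi⟩ := hcover s
  obtain ⟨J, hJ, hγ⟩ := exists_nhds_joined (hU i) hi
  refine ⟨J, hJ, fun a ha b hb => ?_⟩
  obtain ⟨γ, rfl, rfl, hγ⟩ := hγ a ha b hb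
  exact h i γ hγ

end Interval

/-! ### Abstract 2-dimensional cell structures, applied later to both `X` and `X / Y` -/

/-- The data of a 2-dimensional cell complex, with edges parametrized by the unit interval and
faces parametrized by polar coordinates `(θ, ρ)`, where `ρ = 0` is the centre and `ρ = 1` is
the boundary. -/
structure CellStructure (Z : Type*) [TopologicalSpace Z] (E F : Type*) where
  /-- The set of vertices. -/
  verts : Set Z
  /-- The parametrization of an edge. -/
  edge : E → C(I, Z)
  /-- The parametrization of a face. -/
  face : F → C(I × I, Z)
  edge_zero_mem : ∀ e, edge e 0 ∈ verts
  edge_one_mem : ∀ e, edge e 1 ∈ verts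
  edge_notMem : ∀ e s, s ∈ Set.Ioo (0 : I) 1 → edge e s ∉ verts
  edge_inj : ∀ e s e' s', s ∈ Set.Ioo (0 : I) 1 → s' ∈ Set.Ioo (0 : I) 1 →
    edge e s = edge e' s' → e = e' ∧ s = s'
  face_zero : ∀ p θ, face p (θ, 0) = face p (0, 0)
  face_loop : ∀ p ρ, face p (0, ρ) = face p (1, ρ)
  face_one_mem : ∀ p θ, face p (θ, 1) ∈ verts ∪ ⋃ e, Set.range (edge e)
  face_notMem : ∀ p θ ρ, ρ < 1 → face p (θ, ρ) ∉ verts ∪ ⋃ e, Set.range (edge e)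
  face_inj : ∀ p θ ρ p' θ' ρ', ρ < 1 → ρ' < 1 → face p (θ, ρ) = face p' (θ', ρ') →
    p = p' ∧ ρ = ρ' ∧ (ρ = 0 ∨ θ = θ' ∨ (θ = 0 ∧ θ' = 1) ∨ (θ = 1 ∧ θ' = 0))
  cover : ∀ z, z ∉ verts ∪ ⋃ e, Set.range (edge e) → ∃ p θ ρ, ρ < 1 ∧ face p (θ, ρ) = z
  isClosed_of_subset : ∀ A ⊆ verts ∪ ⋃ e, Set.range (edge e),
    (∀ e, IsClosed (edge e ⁻¹' A)) → IsClosed A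
  isClosed_of : ∀ A, (∀ e, IsClosed (edge e ⁻¹' A)) → (∀ p, IsClosed (face p ⁻¹' A)) → IsClosed A

namespace CellStructure

variable {Z : Type*} [TopologicalSpace Z] {E F : Type*} (K : CellStructure Z E F)

/-- The 1-skeleton. -/
def skel : Set Z := K.verts ∪ ⋃ e, Set.range (K.edge e)

/-- The set of the centres of the faces. -/
def centers : Set Z := Set.range fun p => K.face p (0, 0)

/-- An open face. -/
def openFace (p : F) : Set Z := K.face p '' {x | x.2 < 1}

/-- An open edge. -/
def openEdge (e : E) : Set Z := K.edge e '' Set.Ioo 0 1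

variable {K}

theorem edge_mem_skel (e : E) (s : I) : K.edge e s ∈ K.skel :=
  Or.inr (Set.mem_iUnion.2 ⟨e, s, rfl⟩)

theorem face_one_mem_skel (p : F) (θ : I) : K.face p (θ, 1) ∈ K.skel := K.face_one_mem p θ

theorem face_mem_skel_iff {p : F} {θ ρ : I} : K.face p (θ, ρ) ∈ K.skel ↔ ρ = 1 := by
  constructor
  · intro h
    by_contra hρ
    exact K.face_notMem p θ ρ (lt_of_le_of_ne unitInterval.le_one' hρ) h
  · rintro rfl
    exact face_one_mem_skel p θ

theorem edge_mem_verts_iff {e : E} {s : I} : K.edge e s ∈ K.verts ↔ s = 0 ∨ s = 1 := by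
  constructor
  · intro h
    by_contra! hs
    exact K.edge_notMem e s ⟨lt_of_le_of_ne unitInterval.nonneg' hs.1.symm,
      lt_of_le_of_ne unitInterval.le_one' hs.2⟩ h
  · rintro (rfl | rfl)
    exacts [K.edge_zero_mem e, K.edge_one_mem e]

theorem edge_mem_openEdge_iff {e e' : E} {s : I} :
    K.edge e s ∈ K.openEdge e' ↔ e = e' ∧ s ∈ Set.Ioo (0 : I) 1 := by
  constructor
  · rintro ⟨s', hs', h⟩
    have hs : s ∈ Set.Ioo (0 : I) 1 := by
      by_contra hs
      refine K.edge_notMem e' s' hs' (h ▸ edge_mem_verts_iff.2 ?_)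
      by_contra! hne
      exact hs ⟨lt_of_le_of_ne unitInterval.nonneg' hne.1.symm,
        lt_of_le_of_ne unitInterval.le_one' hne.2⟩
    exact ⟨(K.edge_inj _ _ _ _ hs' hs h).1.symm, hs⟩
  · rintro ⟨rfl, hs⟩
    exact ⟨s, hs, rfl⟩

theorem mem_skel_cases {z : Z} (hz : z ∈ K.skel) :
    z ∈ K.verts ∨ ∃ e, ∃ s ∈ Set.Ioo (0 : I) 1, K.edge e s = z := by
  rcases hz with hz | hz
  · exact Or.inl hz
  · obtain ⟨e, s, rfl⟩ := Set.mem_iUnion.1 hz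
    by_cases h : K.edge e s ∈ K.verts
    · exact Or.inl h
    · refine Or.inr ⟨e, s, ?_, rfl⟩
      rw [edge_mem_verts_iff, not_or] at h
      exact ⟨lt_of_le_of_ne unitInterval.nonneg' (Ne.symm h.1),
        lt_of_le_of_ne unitInterval.le_one' h.2⟩

theorem exists_coords {z : Z} (hz : z ∉ K.skel) :
    ∃ c : F × I × I, c.2.2 < 1 ∧ K.face c.1 c.2 = z := by
  obtain ⟨p, θ, ρ, h, rfl⟩ := K.cover z hz
  exact ⟨(p, θ, ρ), h, rfl⟩

theorem openEdge_subset_skel (e : E) : K.openEdge e ⊆ K.skel := by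
  rintro _ ⟨s, -, rfl⟩
  exact edge_mem_skel e s

theorem face_mem_openFace_iff {p p' : F} {θ ρ : I} :
    K.face p (θ, ρ) ∈ K.openFace p' ↔ p = p' ∧ ρ < 1 := by
  constructor
  · rintro ⟨⟨θ', ρ'⟩, h, heq⟩
    have hρ : ρ < 1 := by
      by_contra hρ
      have : ρ = 1 := le_antisymm unitInterval.le_one' (not_lt.1 hρ)
      exact K.face_notMem p' θ' ρ' h (heq ▸ face_mem_skel_iff.2 this)
    exact ⟨(K.face_inj _ _ _ _ _ _ h hρ heq).1.symm, hρ⟩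
  · rintro ⟨rfl, h⟩
    exact ⟨(θ, ρ), h, rfl⟩

theorem edge_notMem_openFace (e : E) (s : I) (p : F) : K.edge e s ∉ K.openFace p := by
  rintro ⟨⟨θ, ρ⟩, h, heq⟩
  exact K.face_notMem p θ ρ h (heq ▸ edge_mem_skel e s)

theorem face_mem_centers_iff {p : F} {θ ρ : I} : K.face p (θ, ρ) ∈ K.centers ↔ ρ = 0 := by
  constructor
  · rintro ⟨p', h⟩
    have hρ : ρ < 1 := (face_mem_openFace_iff.1
      (h ▸ face_mem_openFace_iff.2 ⟨rfl, zero_lt_one⟩ : K.face p (θ, ρ) ∈ K.openFace p')).2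
    exact (K.face_inj _ _ _ _ _ _ zero_lt_one hρ h).2.1.symm
  · rintro rfl
    exact ⟨p, (K.face_zero p θ).symm⟩

theorem skel_disjoint_centers {z : Z} (hz : z ∈ K.skel) : z ∉ K.centers := by
  rintro ⟨p, rfl⟩
  exact K.face_notMem p 0 0 zero_lt_one hz

theorem isOpen_of (A : Set Z) (he : ∀ e, IsOpen (K.edge e ⁻¹' A))
    (hf : ∀ p, IsOpen (K.face p ⁻¹' A)) : IsOpen A := by
  rw [← isClosed_compl_iff]
  exact K.isClosed_of _ (fun e => (he e).isClosed_compl) fun p => (hf p).isClosed_compl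

/-- The set `K.skel \ A` is closed because edges detect closedness within the 1-skeleton. Its
complement is thus an open set of `Z` with the same trace on the 1-skeleton as `A`, which expresses
relative openness without passing to the subtype. -/
theorem isOpen_compl_skel_diff {A : Set Z} (h : ∀ e, IsOpen (K.edge e ⁻¹' A)) :
    IsOpen (K.skel \ A)ᶜ := by
  rw [isOpen_compl_iff]
  refine K.isClosed_of_subset _ Set.sdiff_subset fun e => ?_
  convert (h e).isClosed_compl using 1
  ext s
  exact ⟨fun h => h.2, fun h => ⟨edge_mem_skel e s, h⟩⟩

theorem mem_compl_skel_diff {A : Set Z} {z : Z} (hz : z ∈ K.skel) :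
    z ∈ (K.skel \ A)ᶜ ↔ z ∈ A := by
  simp [hz]

theorem isOpen_compl_centers : IsOpen K.centersᶜ := by
  refine isOpen_of (K := K) _ (fun e => ?_) fun p => ?_
  · convert isOpen_univ
    exact Set.eq_univ_of_forall fun s => skel_disjoint_centers (edge_mem_skel e s)
  · convert isOpen_compl_singleton.preimage (continuous_snd (X := I) (Y := I)) using 1
    ext ⟨θ, ρ⟩
    exact not_congr face_mem_centers_iff

theorem isOpen_openFace (p : F) : IsOpen (K.openFace p) := by
  refine isOpen_of (K := K) _ (fun e => ?_) fun p' => ?_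
  · convert isOpen_empty
    exact Set.eq_empty_of_forall_notMem fun s => edge_notMem_openFace e s p
  · by_cases h : p' = p
    · subst h
      convert (isOpen_Iio (a := (1 : I))).preimage (continuous_snd (X := I) (Y := I)) using 1
      ext ⟨θ, ρ⟩
      exact face_mem_openFace_iff.trans (and_iff_right rfl)
    · convert isOpen_empty
      exact Set.eq_empty_of_forall_notMem fun x hx => h (face_mem_openFace_iff.1 hx).1

theorem continuousOn_of {W : Type*} [TopologicalSpace W] {g : Z → W} {U : Set Z} (hU : IsOpen U)
    (he : ∀ e, ContinuousOn (g ∘ K.edge e) (K.edge e ⁻¹' U))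
    (hf : ∀ p, ContinuousOn (g ∘ K.face p) (K.face p ⁻¹' U)) : ContinuousOn g U := by
  rw [continuousOn_open_iff hU]
  intro t ht
  refine isOpen_of (K := K) _ (fun e => ?_) fun p => ?_
  · exact (continuousOn_open_iff (hU.preimage (K.edge e).continuous)).1 (he e) t ht
  · exact (continuousOn_open_iff (hU.preimage (K.face p).continuous)).1 (hf p) t ht

theorem continuousOn_skel_inter {W : Type*} [TopologicalSpace W] {g : Z → W} {U : Set Z}
    (hU : ∀ e, IsOpen (K.edge e ⁻¹' U))
    (he : ∀ e, ContinuousOn (g ∘ K.edge e) (K.edge e ⁻¹' U)) : ContinuousOn g (K.skel ∩ U) := by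
  rw [continuousOn_iff']
  intro t ht
  refine ⟨_, isOpen_compl_skel_diff (A := U ∩ g ⁻¹' t)
    fun e => (continuousOn_open_iff (hU e)).1 (he e) t ht, ?_⟩
  ext z
  constructor
  · rintro ⟨h1, h2, h3⟩
    exact ⟨(mem_compl_skel_diff h2).2 ⟨h3, h1⟩, h2, h3⟩
  · rintro ⟨h1, h2, h3⟩
    exact ⟨((mem_compl_skel_diff h2).1 h1).2, h2, h3⟩

variable (K)

/-- The radial path `t ↦ face p (θ, (1 - t) a + t b)`. -/
def ray (p : F) (θ a b : I) : C(I, Z) :=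
  (K.face p).comp ((ContinuousMap.const I θ).prodMk (segmentMap a b))

theorem ray_apply (p : F) (θ a b t : I) : K.ray p θ a b t = K.face p (θ, segmentMap a b t) := rfl

theorem ray_self (p : F) (θ a : I) : K.ray p θ a a = ContinuousMap.const I (K.face p (θ, a)) := by
  ext t
  have : segmentMap a a t = a := by
    simpa using segmentMap_mem a a t
  rw [ray_apply, this]
  rfl

theorem continuous_ray (p : F) (b : I) : Continuous fun x : I × I => K.ray p x.1 x.2 b := by
  refine ContinuousMap.continuous_of_continuous_uncurry _ ?_
  refine (K.face p).continuous.comp ((continuous_fst.comp continuous_fst).prodMk ?_)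
  exact Set.Icc.continuous_convexComb_prod.comp ((continuous_snd.comp continuous_fst).prodMk
    (continuous_const.prodMk continuous_snd))

open Classical in
/-- Polar coordinates of a point outside of the 1-skeleton. -/
def slide (b : I) (z : Z) : C(I, Z) :=
  if h : z ∈ K.skel then ContinuousMap.const I z
  else K.ray (exists_coords h).choose.1 (exists_coords h).choose.2.1
    (exists_coords h).choose.2.2 b

variable {K}

theorem slide_of_mem (b : I) {z : Z} (hz : z ∈ K.skel) :
    K.slide b z = ContinuousMap.const I z := dif_pos hz

theorem exists_slide_eq (b : I) {p : F} {θ ρ : I} (hρ : ρ < 1) :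
    ∃ θ', K.slide b (K.face p (θ, ρ)) = K.ray p θ' ρ b ∧ K.face p (θ', ρ) = K.face p (θ, ρ) := by
  have h : K.face p (θ, ρ) ∉ K.skel := fun h => hρ.ne (face_mem_skel_iff.1 h)
  obtain ⟨h1, h2⟩ := (exists_coords h).choose_spec
  rw [slide, dif_neg h]
  generalize (exists_coords h).choose = c at h1 h2
  obtain ⟨p', θ', ρ'⟩ := c
  obtain ⟨rfl, rfl, -⟩ := K.face_inj _ _ _ _ _ _ h1 hρ h2
  exact ⟨θ', rfl, h2⟩

/-- The angle of a point is ambiguous only across the seam `0 ~ 1` and at the centre. Rays on the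
two sides of the seam agree by `face_loop`; at the centre the angle matters only for rays that leave
it, which `h0` excludes. -/
theorem ray_congr {p : F} {θ θ' ρ : I} (b : I) (hρ : ρ < 1) (h0 : 0 < ρ ∨ b = 0)
    (h : K.face p (θ', ρ) = K.face p (θ, ρ)) : K.ray p θ' ρ b = K.ray p θ ρ b := by
  have hl : K.ray p 0 ρ b = K.ray p 1 ρ b := by
    ext t
    exact K.face_loop p _
  obtain ⟨-, -, h | rfl | ⟨rfl, rfl⟩ | ⟨rfl, rfl⟩⟩ := K.face_inj _ _ _ _ _ _ hρ hρ h
  · subst h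
    obtain rfl : b = 0 := h0.resolve_left (lt_irrefl 0)
    rw [ray_self, ray_self, h]
  · rfl
  · exact hl
  · exact hl.symm

theorem slide_face (b : I) {p : F} {θ ρ : I} (hρ : ρ < 1) (h0 : 0 < ρ ∨ b = 0) :
    K.slide b (K.face p (θ, ρ)) = K.ray p θ ρ b := by
  obtain ⟨θ', h, h'⟩ := exists_slide_eq (K := K) b (p := p) (θ := θ) hρ
  rw [h, ray_congr b hρ h0 h']

theorem slide_one_face {p : F} {θ ρ : I} (h0 : 0 < ρ) :
    K.slide 1 (K.face p (θ, ρ)) = K.ray p θ ρ 1 := by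
  rcases (unitInterval.le_one' (t := ρ)).lt_or_eq with h | rfl
  · exact slide_face 1 h (Or.inl h0)
  · rw [slide_of_mem 1 (face_one_mem_skel p θ), ray_self]

theorem slide_apply_zero (b : I) (z : Z) : K.slide b z 0 = z := by
  by_cases h : z ∈ K.skel
  · rw [slide_of_mem b h]; rfl
  · obtain ⟨⟨p, θ, ρ⟩, hρ, rfl⟩ := exists_coords h
    obtain ⟨θ', h1, h2⟩ := exists_slide_eq (K := K) b (p := p) (θ := θ) hρ
    change K.slide b (K.face p (θ, ρ)) 0 = K.face p (θ, ρ)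
    rw [h1, ray_apply, segmentMap_zero, h2]

theorem slide_one_apply_one_mem (z : Z) : K.slide 1 z 1 ∈ K.skel := by
  by_cases h : z ∈ K.skel
  · rw [slide_of_mem 1 h]; exact h
  · obtain ⟨⟨p, θ, ρ⟩, hρ, rfl⟩ := exists_coords h
    obtain ⟨θ', h1, h2⟩ := exists_slide_eq (K := K) 1 (p := p) (θ := θ) hρ
    change K.slide 1 (K.face p (θ, ρ)) 1 ∈ K.skel
    rw [h1, ray_apply, segmentMap_one]
    exact face_one_mem_skel p θ'

theorem slide_one_face_apply_one {p : F} {θ ρ : I} (h0 : 0 < ρ) :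
    K.slide 1 (K.face p (θ, ρ)) 1 = K.face p (θ, 1) := by
  rw [slide_one_face h0, ray_apply, segmentMap_one]

/-- Radial paths towards the boundary depend continuously on the polar coordinates and are constant
on the 1-skeleton; only at the centres is there no preferred direction. -/
theorem continuousOn_slide_one : ContinuousOn (K.slide 1) K.centersᶜ := by
  refine continuousOn_of (K := K) isOpen_compl_centers (fun e => ?_) fun p => ?_
  · refine ((ContinuousMap.continuous_const').comp (K.edge e).continuous).continuousOn.congr ?_
    intro s _
    exact slide_of_mem 1 (edge_mem_skel e s)
  · refine (K.continuous_ray p 1).continuousOn.congr ?_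
    rintro ⟨θ, ρ⟩ h
    have h0 : ρ ≠ 0 := fun h0 => h (face_mem_centers_iff.2 h0)
    exact slide_one_face (lt_of_le_of_ne unitInterval.nonneg' h0.symm)

theorem continuousOn_slide_zero (p : F) : ContinuousOn (K.slide 0) (K.openFace p) := by
  refine continuousOn_of (K := K) (isOpen_openFace p) (fun e => ?_) fun p' => ?_
  · intro s hs
    exact absurd hs (edge_notMem_openFace e s p)
  · refine (K.continuous_ray p' 0).continuousOn.congr ?_
    rintro ⟨θ, ρ⟩ h
    exact slide_face 0 (face_mem_openFace_iff.1 h).2 (Or.inr rfl)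

/-- Away from the centres, the end point of the radial path is a retraction to the 1-skeleton. It
thickens the open cover of the 1-skeleton to one of the complement of the centres. -/
theorem isOpen_retract_preimage {A : Set Z} (h : ∀ e, IsOpen (K.edge e ⁻¹' A)) :
    IsOpen {z | z ∉ K.centers ∧ K.slide 1 z 1 ∈ A} := by
  have hc : ContinuousOn (fun z => K.slide 1 z 1) K.centersᶜ :=
    (continuous_eval_const (1 : I)).comp_continuousOn continuousOn_slide_one
  convert (continuousOn_open_iff isOpen_compl_centers).1 hc _ (isOpen_compl_skel_diff h) using 1
  ext z
  exact and_congr_right fun _ => (mem_compl_skel_diff (slide_one_apply_one_mem z)).symm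

end CellStructure

/-! ### Existence of transports with prescribed values on the edges -/

/-- The midpoint of the unit interval. -/
def half : I := ⟨1 / 2, by norm_num, by norm_num⟩

theorem half_mem_Ioo : half ∈ Set.Ioo (0 : I) 1 := by
  constructor <;> rw [← Subtype.coe_lt_coe] <;> norm_num [half]

namespace CellStructure

variable {Z : Type*} [TopologicalSpace Z] {E F : Type*} (K : CellStructure Z E F)
  {H : Type*} [Group H]

/-- The set of the midpoints of the edges. -/
def midpoints : Set Z := Set.range fun e => K.edge e half

open Classical in
/-- The parameter of a point of an open edge. -/
def position (z : Z) : I :=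
  if h : ∃ e, ∃ s ∈ Set.Ioo (0 : I) 1, K.edge e s = z then h.choose_spec.choose else 0

/-- An open cover of the 1-skeleton, by the complement of the midpoints and the open edges. -/
def graphBase : Option E → Set Z
  | none => K.skel \ K.midpoints
  | some e => K.openEdge e

/-- The coordinates of the bundle on the 1-skeleton with given transport along the edges. -/
def graphCoord (a : E → H) : Option E → Z → H
  | none, _ => 1
  | some e, z => if half < K.position z then (a e)⁻¹ else 1

variable {K}

theorem position_edge {e : E} {s : I} (hs : s ∈ Set.Ioo (0 : I) 1) :
    K.position (K.edge e s) = s := by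
  have h : ∃ e', ∃ s' ∈ Set.Ioo (0 : I) 1, K.edge e' s' = K.edge e s := ⟨e, s, hs, rfl⟩
  rw [position, dif_pos h]
  obtain ⟨h1, h2⟩ := h.choose_spec.choose_spec
  exact (K.edge_inj _ _ _ _ h1 hs h2).2

theorem edge_mem_midpoints_iff {e : E} {s : I} : K.edge e s ∈ K.midpoints ↔ s = half := by
  constructor
  · rintro ⟨e', h⟩
    have h' : K.edge e s ∈ K.openEdge e' := h ▸ ⟨half, half_mem_Ioo, rfl⟩
    exact (K.edge_inj _ _ _ _ half_mem_Ioo (edge_mem_openEdge_iff.1 h').2 h).2.symm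
  · rintro rfl
    exact ⟨e, rfl⟩

theorem edge_mem_graphBase_none_iff {e : E} {s : I} :
    K.edge e s ∈ K.graphBase none ↔ s ≠ half :=
  ⟨fun h hs => h.2 (edge_mem_midpoints_iff.2 hs),
    fun h => ⟨edge_mem_skel e s, fun hs => h (edge_mem_midpoints_iff.1 hs)⟩⟩

theorem exists_mem_graphBase {z : Z} (hz : z ∈ K.skel) : ∃ i, z ∈ K.graphBase i := by
  by_cases h : z ∈ K.midpoints
  · obtain ⟨e, rfl⟩ := h
    exact ⟨some e, half, half_mem_Ioo, rfl⟩
  · exact ⟨none, hz, h⟩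

theorem isOpen_edge_preimage_graphBase (e : E) (i : Option E) :
    IsOpen (K.edge e ⁻¹' K.graphBase i) := by
  cases i with
  | none =>
    convert (isOpen_compl_singleton : IsOpen ({half}ᶜ : Set I)) using 1
    ext s
    exact edge_mem_graphBase_none_iff
  | some e' =>
    by_cases h : e = e'
    · convert (isOpen_Ioo : IsOpen (Set.Ioo (0 : I) 1)) using 1
      ext s
      exact edge_mem_openEdge_iff.trans (and_iff_right h)
    · convert (isOpen_empty : IsOpen (∅ : Set I))
      exact Set.eq_empty_of_forall_notMem fun s hs => h (edge_mem_openEdge_iff.1 hs).1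

theorem eventually_graphCoord_eq (a : E → H) {e : E} {s : I} (hs : s ≠ half) {i : Option E}
    (hi : K.edge e s ∈ K.graphBase i) :
    ∀ᶠ s' in 𝓝 s, K.graphCoord a i (K.edge e s') = K.graphCoord a i (K.edge e s) := by
  cases i with
  | none => exact Filter.Eventually.of_forall fun _ => rfl
  | some e' =>
    have h01 : s ∈ Set.Ioo (0 : I) 1 := (edge_mem_openEdge_iff.1 hi).2
    rcases lt_or_gt_of_ne hs with h | h
    · filter_upwards [isOpen_Ioo.mem_nhds h01, Iio_mem_nhds h] with s' h1 h2
      simp only [graphCoord, position_edge h01, position_edge h1]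
      rw [if_neg (not_lt.2 (le_of_lt h2)), if_neg (not_lt.2 h.le)]
    · filter_upwards [isOpen_Ioo.mem_nhds h01, Ioi_mem_nhds h] with s' h1 h2
      simp only [graphCoord, position_edge h01, position_edge h1]
      rw [if_pos (Set.mem_Ioi.1 h2), if_pos h]

/-- On one member of the cover the ratio is `1`; the overlap of two different members avoids the
midpoints, where alone the coordinates jump. -/
theorem isOpen_edge_preimage_graphCoord (a : E → H) (i j : Option E) (c : H) (e : E) :
    IsOpen (K.edge e ⁻¹' {z | z ∈ K.graphBase i ∧ z ∈ K.graphBase j ∧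
      (K.graphCoord a i z)⁻¹ * K.graphCoord a j z = c}) := by
  rw [isOpen_iff_mem_nhds]
  rintro s ⟨hi, hj, hc⟩
  have h1 := (isOpen_edge_preimage_graphBase e i).mem_nhds hi
  have h2 := (isOpen_edge_preimage_graphBase e j).mem_nhds hj
  by_cases hij : i = j
  · subst hij
    filter_upwards [h1] with s' hs'
    refine ⟨hs', hs', ?_⟩
    rw [← hc, inv_mul_cancel, inv_mul_cancel]
  · have hs : s ≠ half := by
      cases i with
      | none => exact edge_mem_graphBase_none_iff.1 hi
      | some e1 =>
        cases j with
        | none => exact edge_mem_graphBase_none_iff.1 hj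
        | some e2 =>
          exact absurd (congrArg some ((edge_mem_openEdge_iff.1 hi).1.symm.trans
            (edge_mem_openEdge_iff.1 hj).1)) hij
    filter_upwards [h1, h2, eventually_graphCoord_eq a hs hi, eventually_graphCoord_eq a hs hj]
      with s' k1 k2 k3 k4
    exact ⟨k1, k2, by rw [k3, k4, hc]⟩

/-- An edge as a path in the 1-skeleton. -/
def skelEdge (K : CellStructure Z E F) (e : E) : C(I, K.skel) :=
  ⟨fun s => ⟨K.edge e s, edge_mem_skel e s⟩, (K.edge e).continuous.subtype_mk _⟩

/-- The boundary of a face as a path in the 1-skeleton. -/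
def skelBoundary (K : CellStructure Z E F) (p : F) : C(I, K.skel) :=
  ⟨fun θ => ⟨K.face p (θ, 1), face_one_mem_skel p θ⟩,
    ((K.face p).continuous.comp (continuous_id.prodMk continuous_const)).subtype_mk _⟩

/-- The cocycle on the 1-skeleton with given transport along the edges. -/
def graphCocycle (K : CellStructure Z E F) (a : E → H) : Cocycle (Option E) K.skel H where
  baseSet i := Subtype.val ⁻¹' K.graphBase i
  coord i z := K.graphCoord a i z
  exists_mem z := exists_mem_graphBase z.2
  isOpen_coord i j c := by
    convert (isOpen_compl_skel_diff (isOpen_edge_preimage_graphCoord (K := K) a i j c)).preimage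
      (continuous_subtype_val (p := (· ∈ K.skel))) using 1
    ext z
    exact (mem_compl_skel_diff (K := K) (A := {z | z ∈ K.graphBase i ∧ z ∈ K.graphBase j ∧
      (K.graphCoord a i z)⁻¹ * K.graphCoord a j z = c}) z.2).symm

/-- A transport which is given by the graph coordinates on short paths takes the prescribed values
on the edges. -/
theorem arc_edge_of_graphCoord {B : Type*} [TopologicalSpace B] (T : Transport B H) (a : E → H)
    (e : E) (f : C(I, B)) (hT : ∀ (i : Option E) (γ : C(I, I)),
      (∀ t, K.edge e (γ t) ∈ K.graphBase i) → T.arc f (γ 0) (γ 1) =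
        K.graphCoord a i (K.edge e (γ 0)) * (K.graphCoord a i (K.edge e (γ 1)))⁻¹) :
    T.arc f 0 1 = a e := by
  -- The edge is cut at `1/4` and `3/4`. The outer pieces lie in the member `none` and contribute
  -- `1`; the middle piece lies in the open edge and crosses the jump, so it contributes `1 * ((a
  -- e)⁻¹)⁻¹`.
  let q : I := ⟨1 / 4, by norm_num, by norm_num⟩
  let r : I := ⟨3 / 4, by norm_num, by norm_num⟩
  have hq0 : (0 : I) < q := by rw [← Subtype.coe_lt_coe]; norm_num [q]
  have hqh : q < half := by rw [← Subtype.coe_lt_coe]; norm_num [q, half]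
  have hhr : half < r := by rw [← Subtype.coe_lt_coe]; norm_num [r, half]
  have hr1 : r < 1 := by rw [← Subtype.coe_lt_coe]; norm_num [r]
  have hqr : q < r := hqh.trans hhr
  have h1 := hT none (segmentMap 0 q) fun t => edge_mem_graphBase_none_iff.2
    (((Set.uIcc_of_le hq0.le ▸ segmentMap_mem 0 q t : segmentMap 0 q t ∈ Set.Icc 0 q).2.trans_lt
      hqh).ne)
  have h2 := hT (some e) (segmentMap q r) fun t => by
    have ht : segmentMap q r t ∈ Set.Icc q r := Set.uIcc_of_le hqr.le ▸ segmentMap_mem q r t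
    exact edge_mem_openEdge_iff.2 ⟨rfl, hq0.trans_le ht.1, ht.2.trans_lt hr1⟩
  have h3 := hT none (segmentMap r 1) fun t => edge_mem_graphBase_none_iff.2
    ((hhr.trans_le
      (Set.uIcc_of_le hr1.le ▸ segmentMap_mem r 1 t : segmentMap r 1 t ∈ Set.Icc r 1).1).ne')
  rw [segmentMap_zero, segmentMap_one] at h1 h2 h3
  rw [← T.arc_mul f 0 q 1, ← T.arc_mul f q r 1, h1, h2, h3]
  simp [graphCoord, position_edge (K := K) (e := e) ⟨hq0, hqr.trans hr1⟩,
    position_edge (K := K) (e := e) ⟨hq0.trans hqr, hr1⟩, hhr, hqh.le]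

open Classical in
/-- An angular coordinate of a point outside of the 1-skeleton. -/
def angle (K : CellStructure Z E F) (z : Z) : I :=
  if h : z ∈ K.skel then 0 else (exists_coords h).choose.2.1

/-- Strictly between centre and boundary the chosen angle can differ from `θ` only across the seam,
and `hh` makes `h` blind to it. -/
theorem angle_face {H : Type*} (h : I → H) (hh : h 0 = h 1) {p : F} {θ ρ : I} (h0 : 0 < ρ) (h1 : ρ < 1) :
    h (K.angle (K.face p (θ, ρ))) = h θ := by
  have hz : K.face p (θ, ρ) ∉ K.skel := fun h => h1.ne (face_mem_skel_iff.1 h)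
  rw [angle, dif_neg hz]
  obtain ⟨h2, h3⟩ := (exists_coords hz).choose_spec
  generalize (exists_coords hz).choose = c at h2 h3
  obtain ⟨p', θ', ρ'⟩ := c
  obtain ⟨-, rfl, h4 | rfl | ⟨rfl, rfl⟩ | ⟨rfl, rfl⟩⟩ := K.face_inj _ _ _ _ _ _ h2 h1 h3
  · exact absurd h4 h0.ne'
  · rfl
  · exact hh
  · exact hh.symm

/-- The cocycle which extends a flat graph cocycle over the faces; `h p` is the holonomy along the
boundary of `p`, starting at angle `0`. -/
def flatCocycle (K : CellStructure Z E F) (a : E → H) (h : F → I → H) (hh : ∀ p, h p 0 = h p 1)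
    (hopen : ∀ p i c, IsOpen {θ | K.face p (θ, 1) ∈ K.graphBase i ∧
      (K.graphCoord a i (K.face p (θ, 1)))⁻¹ * (h p θ)⁻¹ = c}) :
    Cocycle (Option E ⊕ F) Z H where
  baseSet := Sum.elim (fun i => {z | z ∉ K.centers ∧ K.slide 1 z 1 ∈ K.graphBase i}) K.openFace
  coord := Sum.elim (fun i z => K.graphCoord a i (K.slide 1 z 1)) fun p z => (h p (K.angle z))⁻¹
  exists_mem z := by
    by_cases hz : z ∈ K.skel
    · obtain ⟨i, hi⟩ := exists_mem_graphBase hz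
      refine ⟨Sum.inl i, skel_disjoint_centers hz, ?_⟩
      rw [slide_of_mem 1 hz]
      exact hi
    · obtain ⟨⟨p, x⟩, hx, rfl⟩ := exists_coords hz
      exact ⟨Sum.inr p, x, hx, rfl⟩
  isOpen_coord := by
    -- The mixed overlaps are the only place where flatness enters: in polar coordinates such a set
    -- is an open set of angles times the open interval of radii.
    have key : ∀ i p c, IsOpen {z | (z ∉ K.centers ∧ K.slide 1 z 1 ∈ K.graphBase i) ∧
        z ∈ K.openFace p ∧ (K.graphCoord a i (K.slide 1 z 1))⁻¹ * (h p (K.angle z))⁻¹ = c} := by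
      intro i p c
      refine isOpen_of (K := K) _ (fun e => ?_) fun p' => ?_
      · convert isOpen_empty
        exact Set.eq_empty_of_forall_notMem fun s hs => edge_notMem_openFace e s p hs.2.1
      · by_cases hp : p' = p
        · subst hp
          convert (hopen p' i c).prod (isOpen_Ioo : IsOpen (Set.Ioo (0 : I) 1)) using 1
          ext ⟨θ, ρ⟩
          simp only [Set.mem_preimage, Set.mem_ofPred_eq, Set.mem_prod, face_mem_centers_iff,
            face_mem_openFace_iff, true_and]
          constructor
          · rintro ⟨⟨h0, h2⟩, h1, h3⟩
            have h0 : 0 < ρ := lt_of_le_of_ne unitInterval.nonneg' (Ne.symm h0)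
            rw [slide_one_face_apply_one h0] at h2 h3
            rw [angle_face (h p') (hh p') h0 h1] at h3
            exact ⟨⟨h2, h3⟩, h0, h1⟩
          · rintro ⟨⟨h2, h3⟩, h0, h1⟩
            rw [slide_one_face_apply_one h0, angle_face (h p') (hh p') h0 h1]
            exact ⟨⟨h0.ne', h2⟩, h1, h3⟩
        · convert isOpen_empty
          exact Set.eq_empty_of_forall_notMem fun x hx =>
            hp (face_mem_openFace_iff.1 hx.2.1).1
    rintro (i | p) (j | p') c
    · convert isOpen_retract_preimage (isOpen_edge_preimage_graphCoord (K := K) a i j c) using 1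
      ext z
      simp only [Sum.elim_inl, Set.mem_ofPred_eq]
      tauto
    · exact key i p' c
    · convert key j p c⁻¹ using 1
      ext z
      simp only [Sum.elim_inl, Sum.elim_inr, Set.mem_ofPred_eq]
      rw [← inv_inj (a := _ * _) (b := c), mul_inv_rev, inv_inv]
      tauto
    · by_cases hp : p = p'
      · subst hp
        by_cases hc : 1 = c
        · subst hc
          convert isOpen_openFace (K := K) p using 1
          ext z
          simp
        · convert isOpen_empty
          refine Set.eq_empty_of_forall_notMem fun z hz => hc ?_
          rw [← hz.2.2, inv_mul_cancel]
      · convert isOpen_empty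
        refine Set.eq_empty_of_forall_notMem ?_
        rintro _ ⟨⟨⟨θ, ρ⟩, -, rfl⟩, h2, -⟩
        exact hp (face_mem_openFace_iff.1 h2).1

/-- Every labelling of the edges extends to a transport on the 1-skeleton, and to a transport on the
whole space if it is trivial along the boundaries of the faces. -/
theorem exists_transport (K : CellStructure Z E F) (a : E → H) :
    ∃ T₁ : Transport K.skel H, (∀ e, T₁.arc (K.skelEdge e) 0 1 = a e) ∧
      ((∀ p, T₁.arc (K.skelBoundary p) 0 1 = 1) →
        ∃ T : Transport Z H, ∀ e, T.arc (K.edge e) 0 1 = a e) := by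
  obtain ⟨T₁, hT₁⟩ := (K.graphCocycle a).exists_transport
  refine ⟨T₁, fun e => ?_, fun hflat => ?_⟩
  · refine arc_edge_of_graphCoord (K := K) T₁ a e _ fun i γ hγ => ?_
    rw [← T₁.arc_comp (K.skelEdge e) γ]
    exact hT₁ i _ hγ
  -- Flatness is what makes this partial holonomy take the same value at the angles `0` and `1`, so
  -- that it is a function on the circle.
  · let h : F → I → H := fun p θ => T₁.arc (K.skelBoundary p) 0 θ
    obtain ⟨T, hT⟩ := (K.flatCocycle a h
      (fun p => ((T₁.arc_self _ 0).trans (hflat p).symm)) (by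
        intro p i c
        rw [isOpen_iff_mem_nhds]
        rintro θ ⟨h1, h2⟩
        obtain ⟨J, hJ, hγ⟩ := exists_nhds_joined (((K.graphCocycle a).isOpen_baseSet i).preimage
          (K.skelBoundary p).continuous) (s := θ) h1
        filter_upwards [hJ] with θ' hθ'
        obtain ⟨γ, h3, h4, h5⟩ := hγ θ (mem_of_mem_nhds hJ) θ' hθ'
        refine ⟨by have := h5 1; rw [h4] at this; exact this, ?_⟩
        -- Between nearby angles `h` changes by a quotient of graph coordinates, which cancels in
        -- the transition factor to the face.
        have h6 := hT₁ i ((K.skelBoundary p).comp γ) h5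
        rw [T₁.arc_comp, ContinuousMap.comp_apply, ContinuousMap.comp_apply, h3, h4] at h6
        have h7 : h p θ' = h p θ * _ := (T₁.arc_mul (K.skelBoundary p) 0 θ θ').symm
        rw [h7, h6, ← h2]
        change (K.graphCoord a i (K.face p (θ', 1)))⁻¹ *
          (h p θ * (K.graphCoord a i (K.face p (θ, 1)) *
            (K.graphCoord a i (K.face p (θ', 1)))⁻¹))⁻¹ = _
        group)).exists_transport
    refine ⟨T, fun e => arc_edge_of_graphCoord (K := K) T a e _ fun i γ hγ => ?_⟩
    rw [← T.arc_comp (K.edge e) γ]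
    have := hT (Sum.inl i) ((K.edge e).comp γ) fun t =>
      ⟨skel_disjoint_centers (edge_mem_skel _ _), by
        rw [ContinuousMap.comp_apply, slide_of_mem 1 (edge_mem_skel _ _)]; exact hγ t⟩
    rw [this]
    change K.graphCoord a i (K.slide 1 (K.edge e (γ 0)) 1) *
      (K.graphCoord a i (K.slide 1 (K.edge e (γ 1)) 1))⁻¹ = _
    rw [slide_of_mem 1 (edge_mem_skel _ _), slide_of_mem 1 (edge_mem_skel _ _)]
    rfl

end CellStructure

/-! ### Gauge equivalence of transports along a path -/

section Gauge

variable {Z : Type*} [TopologicalSpace Z] {H : Type*} [Group H]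

/-- The transports `T` and `T'` are related along the image under `f` of a path from `a` to `b` by
the gauge transformation `d`. -/
def GaugeRelated (T T' : Transport Z H) (d : Z → H) {A : Type*} [TopologicalSpace A]
    [SimplyConnectedSpace A] (f : C(A, Z)) (a b : A) : Prop :=
  T'.arc f a b = (d (f a))⁻¹ * T.arc f a b * d (f b)

namespace GaugeRelated

variable {T T' : Transport Z H} {d : Z → H} {A B : Type*} [TopologicalSpace A]
    [SimplyConnectedSpace A] [TopologicalSpace B] [SimplyConnectedSpace B] {f : C(A, Z)} {a b c : A}

theorem trans (h₁ : GaugeRelated T T' d f a b) (h₂ : GaugeRelated T T' d f b c) :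
    GaugeRelated T T' d f a c := by
  unfold GaugeRelated at *
  rw [← T.arc_mul f a b c, ← T'.arc_mul f a b c, h₁, h₂]
  group

theorem symm (h : GaugeRelated T T' d f a b) : GaugeRelated T T' d f b a := by
  unfold GaugeRelated at *
  rw [← T.arc_inv, ← T'.arc_inv, h]
  group

theorem comp_iff {g : C(B, A)} {a b : B} :
    GaugeRelated T T' d (f.comp g) a b ↔ GaugeRelated T T' d f (g a) (g b) := by
  simp only [GaugeRelated, Transport.arc_comp, ContinuousMap.comp_apply]

theorem of_const (h : ∀ x, f x = f a) : GaugeRelated T T' d f a b := by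
  have hf : f = ContinuousMap.const A (f a) := ContinuousMap.ext h
  rw [hf, GaugeRelated, Transport.arc_const, Transport.arc_const]
  simp

/-- If a homotopy, given by paths from the points of `δ`, ends in a path along which
the transports are related, and they are related along its paths, then they are along `δ`. -/
theorem of_homotopy {δ : C(I, Z)} (k : Z → C(I, Z)) (hk : Continuous fun s => k (δ s))
    (h0 : ∀ s, k (δ s) 0 = δ s) (hr : ∀ s, GaugeRelated T T' d (k (δ s)) 0 1)
    (h1 : ∀ g : C(I, Z), (∀ s, g s = k (δ s) 1) → GaugeRelated T T' d g 0 1) :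
    GaugeRelated T T' d δ 0 1 := by
  let κ : C(I, C(I, Z)) := ⟨fun s => k (δ s), hk⟩
  let φ : C(I × I, Z) := κ.uncurry
  have hφ : ∀ s t, φ (s, t) = k (δ s) t := fun _ _ => rfl
  have hv : ∀ s, GaugeRelated T T' d φ (s, 0) (s, 1) := fun s => by
    have : φ.comp ((ContinuousMap.const I s).prodMk (ContinuousMap.id I)) = k (δ s) := by
      ext t; rfl
    have h := hr s
    rw [← this, comp_iff] at h
    exact h
  have hb : ∀ t, GaugeRelated T T' d
      (φ.comp ((ContinuousMap.id I).prodMk (ContinuousMap.const I t))) 0 1 ↔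
        GaugeRelated T T' d φ (0, t) (1, t) := fun t => comp_iff
  have h2 := (hb 1).1 (h1 _ fun s => rfl)
  have hδ : φ.comp ((ContinuousMap.id I).prodMk (ContinuousMap.const I 0)) = δ := by
    ext s; exact h0 s
  rw [← hδ, hb]
  exact ((hv 0).trans h2).trans (hv 1).symm

end GaugeRelated

end Gauge

/-! ### Uniqueness of transports up to gauge -/

namespace CellStructure

variable {Z : Type*} [TopologicalSpace Z] {E F : Type*} {K : CellStructure Z E F}
  {H : Type*} [Group H]

theorem isClosed_of_subset_verts {A : Set Z} (hA : A ⊆ K.verts) : IsClosed A := by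
  refine K.isClosed_of_subset A (hA.trans Set.subset_union_left) fun e => ?_
  refine Set.Finite.isClosed (Set.Finite.subset (Set.toFinite {0, 1}) fun s hs => ?_)
  exact edge_mem_verts_iff.1 (hA hs)

/-- Every set of vertices is closed, so the fibres of `g` are clopen in the connected interval. -/
theorem eq_const_of_mem_verts {g : C(I, Z)} (hg : ∀ s, g s ∈ K.verts) (s t : I) : g s = g t := by
  have h : IsClopen (g ⁻¹' {g t}) := by
    refine ⟨(isClosed_of_subset_verts (K := K) (Set.singleton_subset_iff.2 (hg t))).preimage
      g.continuous, ?_⟩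
    rw [← isClosed_compl_iff]
    convert (isClosed_of_subset_verts (K := K) (A := K.verts \ {g t})
      Set.sdiff_subset).preimage g.continuous using 1
    ext s
    exact ⟨fun h => ⟨hg s, h⟩, fun h => h.2⟩
  exact Set.eq_univ_iff_forall.1 (h.eq_univ ⟨t, rfl⟩) s

variable (K) in
open Classical in
/-- A path from a point of the 1-skeleton which is not a midpoint to a vertex. -/
def toVertex (z : Z) : C(I, Z) :=
  if h : ∃ e, ∃ s ∈ Set.Ioo (0 : I) 1, K.edge e s = z then
    (K.edge h.choose).comp (segmentMap (K.position z) (if K.position z < half then 0 else 1))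
  else ContinuousMap.const I z

theorem toVertex_of_mem {z : Z} (hz : z ∈ K.verts) :
    K.toVertex z = ContinuousMap.const I z := by
  rw [toVertex, dif_neg]
  rintro ⟨e, s, hs, rfl⟩
  exact K.edge_notMem e s hs hz

theorem toVertex_edge_of_mem_Ioo {e : E} {s : I} (hs : s ∈ Set.Ioo (0 : I) 1) :
    K.toVertex (K.edge e s) = (K.edge e).comp (segmentMap s (if s < half then 0 else 1)) := by
  have h : ∃ e', ∃ s' ∈ Set.Ioo (0 : I) 1, K.edge e' s' = K.edge e s := ⟨e, s, hs, rfl⟩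
  rw [toVertex, dif_pos h, position_edge hs]
  obtain ⟨s', hs', h'⟩ := h.choose_spec
  rw [(K.edge_inj _ _ _ _ hs' hs h').1]

theorem comp_segmentMap_self (f : C(I, Z)) (s : I) :
    f.comp (segmentMap s s) = ContinuousMap.const I (f s) := by
  ext t
  have : segmentMap s s t = s := by simpa using segmentMap_mem s s t
  simp [this]

theorem toVertex_edge_of_lt {e : E} {s : I} (hs : s < half) :
    K.toVertex (K.edge e s) = (K.edge e).comp (segmentMap s 0) := by
  rcases (unitInterval.nonneg' (t := s)).eq_or_lt with rfl | h
  · rw [toVertex_of_mem (K.edge_zero_mem e), comp_segmentMap_self]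
  · rw [toVertex_edge_of_mem_Ioo ⟨h, hs.trans half_mem_Ioo.2⟩, if_pos hs]

theorem toVertex_edge_of_gt {e : E} {s : I} (hs : half < s) :
    K.toVertex (K.edge e s) = (K.edge e).comp (segmentMap s 1) := by
  rcases (unitInterval.le_one' (t := s)).eq_or_lt with rfl | h
  · rw [toVertex_of_mem (K.edge_one_mem e), comp_segmentMap_self]
  · rw [toVertex_edge_of_mem_Ioo ⟨half_mem_Ioo.1.trans hs, h⟩, if_neg (not_lt.2 hs.le)]

theorem continuous_comp_segmentMap (f : C(I, Z)) (b : I) :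
    Continuous fun s => f.comp (segmentMap s b) := by
  refine ContinuousMap.continuous_of_continuous_uncurry _ (f.continuous.comp ?_)
  exact Set.Icc.continuous_convexComb_prod.comp (continuous_fst.prodMk
    (continuous_const.prodMk continuous_snd))

/-- The direction of the flow to the vertices changes only at the midpoints, which are removed here.
Towards a vertex the path shrinks to the constant one, so the pieces fit together. -/
theorem continuousOn_toVertex : ContinuousOn K.toVertex (K.graphBase none) := by
  have hpre : ∀ e, K.edge e ⁻¹' K.midpointsᶜ = {half}ᶜ := fun e => by
    ext s
    exact not_congr edge_mem_midpoints_iff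
  refine continuousOn_skel_inter (U := K.midpointsᶜ) (fun e => ?_) fun e => ?_
  · rw [hpre]
    exact isOpen_compl_singleton
  · rw [hpre, ← Set.Iio_union_Ioi]
    refine ContinuousOn.union_of_isOpen ?_ ?_ isOpen_Iio isOpen_Ioi
    · exact (continuous_comp_segmentMap (K.edge e) 0).continuousOn.congr
        fun s hs => toVertex_edge_of_lt hs
    · exact (continuous_comp_segmentMap (K.edge e) 1).continuousOn.congr
        fun s hs => toVertex_edge_of_gt hs

theorem exists_toVertex_eq {z : Z} (hz : z ∈ K.skel) :
    (z ∈ K.verts ∧ K.toVertex z = ContinuousMap.const I z) ∨ ∃ e s b, K.edge e s = z ∧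
      (b = 0 ∨ b = 1) ∧ K.toVertex z = (K.edge e).comp (segmentMap s b) := by
  rcases mem_skel_cases hz with hz | ⟨e, s, hs, rfl⟩
  · exact Or.inl ⟨hz, toVertex_of_mem hz⟩
  · refine Or.inr ⟨e, s, _, rfl, ?_, toVertex_edge_of_mem_Ioo hs⟩
    split_ifs <;> simp

theorem continuousOn_position (e : E) : ContinuousOn K.position (K.openEdge e) := by
  have hpre : ∀ e', K.edge e' ⁻¹' K.openEdge e = {s | e' = e ∧ s ∈ Set.Ioo (0 : I) 1} := fun e' => by
    ext s
    exact edge_mem_openEdge_iff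
  have h := continuousOn_skel_inter (K := K) (g := K.position) (U := K.openEdge e)
    (fun e' => isOpen_edge_preimage_graphBase e' (some e)) fun e' => by
      refine continuousOn_id.congr fun s hs => ?_
      exact position_edge (edge_mem_openEdge_iff.1 hs).2
  rwa [Set.inter_eq_right.2 (openEdge_subset_skel e)] at h

theorem isOpen_path_preimage_graphBase {δ : C(I, Z)} (hδ : ∀ s, δ s ∈ K.skel) (i : Option E) :
    IsOpen (δ ⁻¹' K.graphBase i) := by
  convert (isOpen_compl_skel_diff (K := K) (A := K.graphBase i)
    fun e => isOpen_edge_preimage_graphBase e i).preimage δ.continuous using 1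
  ext s
  exact (mem_compl_skel_diff (hδ s)).symm

/-- Two transports which are related by a gauge transformation along all edges are related along all
paths between points of the 1-skeleton, in the 1-skeleton. -/
theorem exists_gaugeRelated_skel (T T' : Transport Z H) (d : Z → H)
    (h : ∀ e, GaugeRelated T T' d (K.edge e) 0 1) :
    ∃ d' : Z → H, (∀ v ∈ K.verts, d' v = d v) ∧ (∀ e s t, GaugeRelated T T' d' (K.edge e) s t) ∧
      ∀ δ : C(I, Z), (∀ s, δ s ∈ K.skel) → GaugeRelated T T' d' δ 0 1 := by
  classical
  -- At an interior point of an edge, the value of the gauge function is forced by the relation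
  -- along the segment back to the initial vertex.
  let d' : Z → H := fun z => if hz : ∃ e, ∃ s ∈ Set.Ioo (0 : I) 1, K.edge e s = z then
    T.arc (K.edge hz.choose) (K.position z) 0 * d (K.edge hz.choose 0) *
      (T'.arc (K.edge hz.choose) (K.position z) 0)⁻¹ else d z
  have hd : ∀ v ∈ K.verts, d' v = d v := fun v hv => by
    refine dif_neg ?_
    rintro ⟨e, s, hs, rfl⟩
    exact K.edge_notMem e s hs hv
  have hd' : ∀ e, ∀ s ∈ Set.Ioo (0 : I) 1, d' (K.edge e s) =
      T.arc (K.edge e) s 0 * d (K.edge e 0) * (T'.arc (K.edge e) s 0)⁻¹ := fun e s hs => by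
    have hz : ∃ e', ∃ s' ∈ Set.Ioo (0 : I) 1, K.edge e' s' = K.edge e s := ⟨e, s, hs, rfl⟩
    refine (dif_pos hz).trans ?_
    obtain ⟨s', hs', h'⟩ := hz.choose_spec
    rw [position_edge hs, (K.edge_inj _ _ _ _ hs' hs h').1]
  have hzero : ∀ e s, GaugeRelated T T' d' (K.edge e) s 0 := fun e s => by
    by_cases hs : s ∈ Set.Ioo (0 : I) 1
    · rw [GaugeRelated, hd' e s hs, hd _ (K.edge_zero_mem e)]
      group
    · have : K.edge e s ∈ K.verts := by
        by_contra hv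
        rw [edge_mem_verts_iff, not_or] at hv
        exact hs ⟨lt_of_le_of_ne unitInterval.nonneg' (Ne.symm hv.1),
          lt_of_le_of_ne unitInterval.le_one' hv.2⟩
      rcases edge_mem_verts_iff.1 this with rfl | rfl
      · rw [GaugeRelated, T.arc_self, T'.arc_self]
        simp
      · refine GaugeRelated.symm ?_
        have := h e
        rwa [GaugeRelated, ← hd _ (K.edge_zero_mem e), ← hd _ (K.edge_one_mem e)] at this
  have hedge : ∀ e s t, GaugeRelated T T' d' (K.edge e) s t := fun e s t =>
    (hzero e s).trans (hzero e t).symm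
  refine ⟨d', hd, hedge, fun δ hδ => ?_⟩
  refine rel_zero_one_of_cover (GaugeRelated T T' d' δ) (fun a b c => GaugeRelated.trans)
    (fun i : Option E => δ ⁻¹' K.graphBase i) (isOpen_path_preimage_graphBase hδ)
    (fun s => exists_mem_graphBase (hδ s)) ?_
  rintro (_ | e) γ hγ
  · rw [← GaugeRelated.comp_iff]
    -- Off the midpoints, the path is pushed to the vertices; it becomes a path of vertices, which
    -- is constant.
    refine GaugeRelated.of_homotopy K.toVertex
      (continuousOn_toVertex.comp_continuous (δ.comp γ).continuous hγ) (fun s => ?_)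
      (fun s => ?_) fun g hg => ?_
    · rcases exists_toVertex_eq (hδ (γ s)) with ⟨-, h⟩ | ⟨e, t, b, h1, -, h2⟩
      · change K.toVertex (δ (γ s)) 0 = δ (γ s)
        rw [h]; rfl
      · change K.toVertex (δ (γ s)) 0 = δ (γ s)
        rw [h2, ContinuousMap.comp_apply, segmentMap_zero, h1]
    · rcases exists_toVertex_eq (hδ (γ s)) with ⟨-, h⟩ | ⟨e, t, b, h1, -, h2⟩
      · change GaugeRelated T T' d' (K.toVertex (δ (γ s))) 0 1
        rw [h]
        exact GaugeRelated.of_const fun _ => rfl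
      · change GaugeRelated T T' d' (K.toVertex (δ (γ s))) 0 1
        rw [h2, GaugeRelated.comp_iff]
        exact hedge e _ _
    · refine GaugeRelated.of_const fun s => eq_const_of_mem_verts (K := K) (fun s => ?_) s 0
      rw [hg]
      change K.toVertex (δ (γ s)) 1 ∈ K.verts
      rcases exists_toVertex_eq (hδ (γ s)) with ⟨h, h'⟩ | ⟨e, t, b, h1, h3, h2⟩
      · rw [h']; exact h
      · rw [h2, ContinuousMap.comp_apply, segmentMap_one]
        exact edge_mem_verts_iff.2 h3
  -- Within an open edge, the path factors through the parametrization of the edge.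
  · let τ : C(I, I) := ⟨fun t => K.position (δ (γ t)),
      (continuousOn_position e).comp_continuous (δ.comp γ).continuous hγ⟩
    have : δ.comp γ = (K.edge e).comp τ := by
      ext t
      obtain ⟨s, hs, h⟩ := hγ t
      change δ (γ t) = K.edge e (K.position (δ (γ t)))
      rw [← h, position_edge hs]
    rw [← GaugeRelated.comp_iff, this, GaugeRelated.comp_iff]
    exact hedge e _ _

/-- Two transports which are related by a gauge transformation along all edges are related along all
paths between vertices. -/
theorem gaugeRelated_of_edge (K : CellStructure Z E F) (T T' : Transport Z H) (d : Z → H)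
    (h : ∀ e, T'.arc (K.edge e) 0 1 = (d (K.edge e 0))⁻¹ * T.arc (K.edge e) 0 1 * d (K.edge e 1))
    {x y : Z} (hx : x ∈ K.verts) (hy : y ∈ K.verts) (p : Path.Homotopic.Quotient x y) :
    T'.toFun p = (d x)⁻¹ * T.toFun p * d y := by
  obtain ⟨d₁, hd₁, hedge, hskel⟩ := exists_gaugeRelated_skel T T' d h
  -- The gauge function is extended over the faces by forcing the relation along the radial paths to
  -- the boundary.
  let d' : Z → H := fun z => T.arc (K.slide 1 z) 0 1 * d₁ (K.slide 1 z 1) *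
    (T'.arc (K.slide 1 z) 0 1)⁻¹
  have hd' : ∀ z ∈ K.skel, d' z = d₁ z := fun z hz => by
    simp only [d', slide_of_mem 1 hz, Transport.arc_const]
    simp
  have hslide : ∀ z, GaugeRelated T T' d' (K.slide 1 z) 0 1 := fun z => by
    rw [GaugeRelated, slide_apply_zero, hd' _ (slide_one_apply_one_mem z)]
    simp only [d']
    group
  have hskel' : ∀ δ : C(I, Z), (∀ s, δ s ∈ K.skel) → GaugeRelated T T' d' δ 0 1 := fun δ hδ => by
    have := hskel δ hδ
    rwa [GaugeRelated, ← hd' _ (hδ 0), ← hd' _ (hδ 1)] at this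
  have hbdry : ∀ p θ θ', GaugeRelated T T' d' (K.face p) (θ, 1) (θ', 1) := fun p θ θ' => by
    have := hskel' ((K.face p).comp ((segmentMap θ θ').prodMk (ContinuousMap.const I 1)))
      fun s => face_one_mem_skel p _
    rw [GaugeRelated.comp_iff] at this
    simpa [ContinuousMap.prod_eval, segmentMap_zero, segmentMap_one] using this
  have hray : ∀ p θ a b, GaugeRelated T T' d' (K.ray p θ a b) 0 1 ↔
      GaugeRelated T T' d' (K.face p) (θ, a) (θ, b) := fun p θ a b => by
    rw [ray, GaugeRelated.comp_iff]
    simp [ContinuousMap.prod_eval, segmentMap_zero, segmentMap_one]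
  have hradial : ∀ p θ ρ, GaugeRelated T T' d' (K.face p) (θ, ρ) (θ, 1) := fun p θ ρ => by
    rcases (unitInterval.nonneg' (t := ρ)).eq_or_lt with rfl | h0
    -- At the centre, `slide` follows some unknown angle `θ'`. The path turns from `θ` to `θ'` on
    -- the degenerate circle of radius `0`, goes out, and turns back along the boundary.
    · obtain ⟨θ', h1, -⟩ := exists_slide_eq (K := K) 1 (p := p) (θ := θ) zero_lt_one
      have h2 := hslide (K.face p (θ, 0))
      rw [h1, hray] at h2
      have h3 : GaugeRelated T T' d' ((K.face p).comp ((segmentMap θ θ').prodMk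
          (ContinuousMap.const I 0))) 0 1 := GaugeRelated.of_const fun s => by
        simp only [ContinuousMap.comp_apply, ContinuousMap.prod_eval, ContinuousMap.const_apply]
        rw [K.face_zero, K.face_zero p (segmentMap θ θ' 0)]
      rw [GaugeRelated.comp_iff] at h3
      simp only [ContinuousMap.prod_eval, segmentMap_zero, segmentMap_one,
        ContinuousMap.const_apply] at h3
      exact (h3.trans h2).trans (hbdry p θ' θ)
    · have h := hslide (K.face p (θ, ρ))
      rwa [slide_one_face h0, hray] at h
  have hface : ∀ p a b, GaugeRelated T T' d' (K.face p) a b := fun p a b =>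
    ((hradial p a.1 a.2).trans (hbdry p a.1 b.1)).trans (hradial p b.1 b.2).symm
  have hall : ∀ δ : C(I, Z), GaugeRelated T T' d' δ 0 1 := fun δ => by
    refine rel_zero_one_of_cover (GaugeRelated T T' d' δ) (fun a b c => GaugeRelated.trans)
      (fun i : Option F => δ ⁻¹' i.elim K.centersᶜ K.openFace) ?_ ?_ ?_
    · rintro (_ | p)
      · exact isOpen_compl_centers.preimage δ.continuous
      · exact (isOpen_openFace p).preimage δ.continuous
    · intro s
      by_cases hs : δ s ∈ K.centers
      · obtain ⟨p, hp⟩ := hs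
        exact ⟨some p, (0, 0), zero_lt_one (α := I), hp⟩
      · exact ⟨none, hs⟩
    -- Off the centres the path is pushed out to the 1-skeleton; in an open face it is contracted to
    -- the centre.
    · rintro (_ | p) γ hγ
      · rw [← GaugeRelated.comp_iff]
        refine GaugeRelated.of_homotopy (K.slide 1)
          (continuousOn_slide_one.comp_continuous (δ.comp γ).continuous hγ)
          (fun s => slide_apply_zero 1 _) (fun s => hslide _) fun g hg => ?_
        exact hskel' g fun s => hg s ▸ slide_one_apply_one_mem _
      · rw [← GaugeRelated.comp_iff]
        have key : ∀ s, ∃ θ ρ, K.slide 0 (δ.comp γ s) = K.ray p θ ρ 0 := fun s => by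
          obtain ⟨⟨θ, ρ⟩, hρ, h⟩ := hγ s
          refine ⟨θ, ρ, ?_⟩
          rw [ContinuousMap.comp_apply, ← h, slide_face 0 hρ (Or.inr rfl)]
        refine GaugeRelated.of_homotopy (K.slide 0)
          ((continuousOn_slide_zero p).comp_continuous (δ.comp γ).continuous hγ)
          (fun s => slide_apply_zero 0 _) (fun s => ?_) fun g hg => GaugeRelated.of_const fun s => ?_
        · obtain ⟨θ, ρ, h⟩ := key s
          rw [h, hray]
          exact hface p _ _
        · obtain ⟨θ, ρ, h⟩ := key s
          obtain ⟨θ', ρ', h'⟩ := key 0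
          rw [hg, hg, h, h', ray_apply, ray_apply, segmentMap_one, segmentMap_one, K.face_zero,
            K.face_zero p θ']
  induction p using Path.Homotopic.Quotient.ind with | mk p => ?_
  have := hall p.toContinuousMap
  rw [GaugeRelated, ← T.toFun_mk, ← T'.toFun_mk] at this
  rw [this]
  have h0 : p.toContinuousMap 0 = x := p.source
  have h1 : p.toContinuousMap 1 = y := p.target
  rw [h0, h1, hd' x (Or.inl hx), hd' y (Or.inl hy), hd₁ x hx, hd₁ y hy]

/-! ### Connectedness -/

/-- In a connected space, a set of vertices which contains with one end of an edge also the other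
one contains all vertices or none. -/
theorem verts_subset_of_edge [PreconnectedSpace Z] (K : CellStructure Z E F) {A : Set Z}
    (hA : A ⊆ K.verts) (hne : A.Nonempty) (h : ∀ e, K.edge e 0 ∈ A ↔ K.edge e 1 ∈ A) :
    K.verts ⊆ A := by
  -- The subgraph spanned by `A`. The subgraphs of `A` and of its complement in the vertices
  -- partition the 1-skeleton into two closed sets.
  let B : Set Z → Set Z := fun A => A ∪ ⋃ e, {z | K.edge e 0 ∈ A ∧ z ∈ Set.range (K.edge e)}
  have hBskel : ∀ A ⊆ K.verts, B A ⊆ K.skel := by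
    rintro A hA z (hz | hz)
    · exact Or.inl (hA hz)
    · obtain ⟨e, -, s, rfl⟩ := Set.mem_iUnion.1 hz
      exact edge_mem_skel e s
  have hBedge : ∀ A ⊆ K.verts, (∀ e, K.edge e 0 ∈ A ↔ K.edge e 1 ∈ A) → ∀ e s,
      K.edge e s ∈ B A ↔ K.edge e 0 ∈ A := by
    intro A hA h e s
    constructor
    · rintro (hz | hz)
      · rcases edge_mem_verts_iff.1 (hA hz) with rfl | rfl
        exacts [hz, (h e).2 hz]
      · obtain ⟨e', h0, s', heq⟩ := Set.mem_iUnion.1 hz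
        by_cases hs : s ∈ Set.Ioo (0 : I) 1
        · have : K.edge e' s' ∈ K.openEdge e := heq ▸ ⟨s, hs, rfl⟩
          obtain ⟨rfl, -⟩ := edge_mem_openEdge_iff.1 this
          exact h0
        · have hs' : s' = 0 ∨ s' = 1 := by
            by_contra hs'
            have h2 : s' ∈ Set.Ioo (0 : I) 1 := by
              rw [not_or] at hs'
              exact ⟨lt_of_le_of_ne unitInterval.nonneg' (Ne.symm hs'.1),
                lt_of_le_of_ne unitInterval.le_one' hs'.2⟩
            exact hs (edge_mem_openEdge_iff.1 (heq ▸ ⟨s', h2, rfl⟩ :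
              K.edge e s ∈ K.openEdge e')).2
          have hmem : K.edge e s ∈ A := by
            rw [← heq]
            rcases hs' with rfl | rfl
            exacts [h0, (h e').1 h0]
          rcases edge_mem_verts_iff.1 (hA hmem) with rfl | rfl
          exacts [hmem, (h e).2 hmem]
    · intro h0
      exact Or.inr (Set.mem_iUnion.2 ⟨e, h0, s, rfl⟩)
  have hBclosed : ∀ A ⊆ K.verts, (∀ e, K.edge e 0 ∈ A ↔ K.edge e 1 ∈ A) → IsClosed (B A) := by
    intro A hA h
    refine K.isClosed_of_subset _ (hBskel A hA) fun e => ?_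
    have : K.edge e ⁻¹' B A = {_s : I | K.edge e 0 ∈ A} := by
      ext s
      exact hBedge A hA h e s
    rw [this]
    exact isClosed_const
  let A' := K.verts \ A
  have hA' : A' ⊆ K.verts := Set.sdiff_subset
  have h' : ∀ e, K.edge e 0 ∈ A' ↔ K.edge e 1 ∈ A' := fun e =>
    and_congr (iff_of_true (K.edge_zero_mem e) (K.edge_one_mem e)) (not_congr (h e))
  have hcompl : ∀ z ∈ K.skel, z ∈ B A' ↔ z ∉ B A := by
    intro z hz
    rcases mem_skel_cases hz with hz | ⟨e, s, hs, rfl⟩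
    · have hvert : ∀ A ⊆ K.verts, (∀ e, K.edge e 0 ∈ A ↔ K.edge e 1 ∈ A) → (z ∈ B A ↔ z ∈ A) := by
        intro A hA h
        refine ⟨?_, Or.inl⟩
        rintro (hz' | hz')
        · exact hz'
        · obtain ⟨e, h0, s, rfl⟩ := Set.mem_iUnion.1 hz'
          rcases edge_mem_verts_iff.1 hz with rfl | rfl
          exacts [h0, (h e).1 h0]
      rw [hvert A hA h, hvert A' hA' h']
      exact and_iff_right hz
    · rw [hBedge A hA h, hBedge A' hA' h']
      exact and_iff_right (K.edge_zero_mem e)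
  have hclosed : ∀ A₁ A₂ : Set Z, IsClosed (B A₁) → IsClosed (B A₂) →
      (∀ z ∈ K.skel, z ∈ B A₂ ↔ z ∉ B A₁) → IsClosed {z | K.slide 1 z 1 ∈ B A₁} := by
    intro A₁ A₂ h₁ h₂ h₁₂
    refine K.isClosed_of _ (fun e => ?_) fun p => ?_
    · convert h₁.preimage (K.edge e).continuous using 1
      ext s
      change K.slide 1 (K.edge e s) 1 ∈ B A₁ ↔ _
      rw [slide_of_mem 1 (edge_mem_skel e s)]
      rfl
    -- The radial projection is not continuous at the centre, but the boundary circle of a face is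
    -- connected and lies entirely in one of the two subgraphs, so the preimage in the face is
    -- everything or empty.
    · have hcl : IsClopen ((fun θ => K.face p (θ, 1)) ⁻¹' B A₁) := by
        have hc : Continuous fun θ => K.face p (θ, 1) := by fun_prop
        refine ⟨h₁.preimage hc, ?_⟩
        rw [← isClosed_compl_iff]
        convert h₂.preimage hc using 1
        ext θ
        exact (h₁₂ _ (face_one_mem_skel p θ)).symm
      have hmem : ∀ x, ∃ θ, K.slide 1 (K.face p x) 1 = K.face p (θ, 1) := by
        rintro ⟨θ, ρ⟩
        rcases (unitInterval.le_one' (t := ρ)).lt_or_eq with h | rfl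
        · obtain ⟨θ', h1, -⟩ := exists_slide_eq (K := K) 1 (p := p) (θ := θ) h
          exact ⟨θ', by rw [h1, ray_apply, segmentMap_one]⟩
        · exact ⟨θ, by rw [slide_of_mem 1 (face_one_mem_skel p θ)]; rfl⟩
      rcases isClopen_iff.1 hcl with hcl | hcl
      · convert isClosed_empty
        refine Set.eq_empty_of_forall_notMem fun x hx => ?_
        obtain ⟨θ, hθ⟩ := hmem x
        exact Set.eq_empty_iff_forall_notMem.1 hcl θ (by
          change K.slide 1 (K.face p x) 1 ∈ B A₁ at hx
          rwa [hθ] at hx)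
      · convert isClosed_univ
        refine Set.eq_univ_of_forall fun x => ?_
        obtain ⟨θ, hθ⟩ := hmem x
        change K.slide 1 (K.face p x) 1 ∈ B A₁
        rw [hθ]
        exact Set.eq_univ_iff_forall.1 hcl θ
  have hc := hclosed A A' (hBclosed A hA h) (hBclosed A' hA' h') hcompl
  have hc' := hclosed A' A (hBclosed A' hA' h') (hBclosed A hA h) fun z hz => by
    rw [hcompl z hz, not_not]
  have hclopen : IsClopen {z | K.slide 1 z 1 ∈ B A} := by
    refine ⟨hc, ?_⟩
    rw [← isClosed_compl_iff]
    convert hc' using 1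
    ext z
    exact (hcompl _ (slide_one_apply_one_mem z)).symm
  have hself : ∀ v ∈ K.verts, K.slide 1 v 1 = v := fun v hv => by
    rw [slide_of_mem 1 (Or.inl hv)]; rfl
  obtain ⟨v₀, hv₀⟩ := hne
  have huniv := hclopen.eq_univ ⟨v₀, by
    change K.slide 1 v₀ 1 ∈ B A
    rw [hself v₀ (hA hv₀)]; exact Or.inl hv₀⟩
  intro v hv
  by_contra hvA
  have h1 : K.slide 1 v 1 ∈ B A := Set.eq_univ_iff_forall.1 huniv v
  rw [hself v hv] at h1
  exact (hcompl v (Or.inl hv)).1 (Or.inl ⟨hv, hvA⟩) h1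

theorem joined_edge (e : E) (s : I) : Joined (K.edge e 0) (K.edge e s) :=
  ⟨⟨(K.edge e).comp (segmentMap 0 s), by simp [segmentMap_zero], by simp [segmentMap_one]⟩⟩

/-- Radial paths lead to the 1-skeleton, edges lead to vertices, and the vertices joined to `v` are
stable under passing along edges. -/
theorem pathConnectedSpace [ConnectedSpace Z] (K : CellStructure Z E F) {v : Z} (hv : v ∈ K.verts) :
    PathConnectedSpace Z := by
  have hverts := K.verts_subset_of_edge (A := {w | w ∈ K.verts ∧ Joined v w}) (fun w h => h.1)
    ⟨v, hv, Joined.refl v⟩ fun e => by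
      refine and_congr (iff_of_true (K.edge_zero_mem e) (K.edge_one_mem e)) ?_
      exact ⟨fun h => h.trans (joined_edge e 1), fun h => h.trans (joined_edge e 1).symm⟩
  have hskel : ∀ z ∈ K.skel, Joined v z := fun z hz => by
    rcases mem_skel_cases hz with hz | ⟨e, s, -, rfl⟩
    · exact (hverts hz).2
    · exact (hverts (K.edge_zero_mem e)).2.trans (joined_edge e s)
  have hall : ∀ z, Joined v z := fun z =>
    (hskel _ (slide_one_apply_one_mem z)).trans
      (Joined.symm ⟨⟨K.slide 1 z, slide_apply_zero 1 z, rfl⟩⟩)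
  exact ⟨⟨v⟩, fun x y => (hall x).symm.trans (hall y)⟩

end CellStructure

/-! ### Polar coordinates on the square -/

section Polar

/-- Both vectors are positive multiples of Euclidean unit vectors, so the factors agree and the
angles agree modulo `2π`; parameters in the unit interval then differ by `-1`, `0` or `1`. -/
theorem squareBoundary_inj {s t : I} (h : squareBoundary s = squareBoundary t) :
    s = t ∨ (s = 0 ∧ t = 1) ∨ (s = 1 ∧ t = 0) := by
  have hs := inv_pos.2 (norm_pos_iff.2 (squareBoundary_ne s))
  have ht := inv_pos.2 (norm_pos_iff.2 (squareBoundary_ne t))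
  rw [squareBoundary, squareBoundary] at h
  generalize ‖![Real.cos (2 * Real.pi * s), Real.sin (2 * Real.pi * s)]‖⁻¹ = k at h hs
  generalize ‖![Real.cos (2 * Real.pi * t), Real.sin (2 * Real.pi * t)]‖⁻¹ = l at h ht
  have h0 : k * Real.cos (2 * Real.pi * s) = l * Real.cos (2 * Real.pi * t) := congrFun h 0
  have h1 : k * Real.sin (2 * Real.pi * s) = l * Real.sin (2 * Real.pi * t) := congrFun h 1
  have hkl : k = l := by
    have h2 : k ^ 2 = l ^ 2 := by
      have e1 := Real.cos_sq_add_sin_sq (2 * Real.pi * s)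
      have e2 := Real.cos_sq_add_sin_sq (2 * Real.pi * t)
      calc k ^ 2 = (k * Real.cos (2 * Real.pi * s)) ^ 2 + (k * Real.sin (2 * Real.pi * s)) ^ 2 := by
            rw [mul_pow, mul_pow, ← mul_add, e1, mul_one]
        _ = l ^ 2 := by rw [h0, h1, mul_pow, mul_pow, ← mul_add, e2, mul_one]
    exact (pow_left_inj₀ hs.le ht.le two_ne_zero).1 h2
  subst hkl
  have h3 := Real.Angle.cos_sin_inj (mul_left_cancel₀ hs.ne' h0) (mul_left_cancel₀ hs.ne' h1)
  obtain ⟨n, hn⟩ := Real.Angle.angle_eq_iff_two_pi_dvd_sub.1 h3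
  have h4 : (s : ℝ) - t = n := by
    rw [← mul_sub] at hn
    exact mul_left_cancel₀ Real.two_pi_pos.ne' hn
  have hs0 := s.2.1
  have hs1 := s.2.2
  have ht0 := t.2.1
  have ht1 := t.2.2
  have hn1 : (n : ℝ) < ((2 : ℤ) : ℝ) := by push_cast; linarith
  have hn2 : ((-2 : ℤ) : ℝ) < n := by push_cast; linarith
  have hn1' := Int.cast_lt.1 hn1
  have hn2' := Int.cast_lt.1 hn2
  obtain rfl | rfl | rfl : n = -1 ∨ n = 0 ∨ n = 1 := by omega
  · refine Or.inr (Or.inl ⟨Subtype.ext ?_, Subtype.ext ?_⟩)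
    · push_cast at h4 ⊢
      linarith
    · push_cast at h4 ⊢
      linarith
  · refine Or.inl (Subtype.ext ?_)
    push_cast at h4
    linarith
  · refine Or.inr (Or.inr ⟨Subtype.ext ?_, Subtype.ext ?_⟩)
    · push_cast at h4 ⊢
      linarith
    · push_cast at h4 ⊢
      linarith

theorem norm_smul_squareBoundary (θ ρ : I) : ‖(ρ : ℝ) • squareBoundary θ‖ = ρ := by
  rw [norm_smul, norm_squareBoundary, mul_one, Real.norm_of_nonneg ρ.2.1]

theorem squareBoundary_zero_eq_one : squareBoundary 0 = squareBoundary 1 := by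
  simp [squareBoundary]

theorem exists_smul_squareBoundary {c : Fin 2 → ℝ} (hc : ‖c‖ ≤ 1) :
    ∃ θ ρ : I, (ρ : ℝ) • squareBoundary θ = c := by
  by_cases h0 : c = 0
  · exact ⟨0, 0, by simp [h0]⟩
  let z : ℂ := ⟨c 0, c 1⟩
  have hz : z ≠ 0 := by
    intro hz
    refine h0 (funext fun i => ?_)
    fin_cases i
    · exact congrArg Complex.re hz
    · exact congrArg Complex.im hz
  have hpi := Real.pi_pos
  -- The argument lies in `(-π, π]`; negative values are shifted by `2π` to obtain a parameter in
  -- the unit interval.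
  obtain ⟨θ, hcos, hsin⟩ : ∃ θ : I, Real.cos (2 * Real.pi * θ) = Real.cos z.arg ∧
      Real.sin (2 * Real.pi * θ) = Real.sin z.arg := by
    have h1 := Complex.neg_pi_lt_arg z
    have h2 := Complex.arg_le_pi z
    rcases le_or_gt 0 z.arg with h | h
    · refine ⟨⟨z.arg / (2 * Real.pi), by positivity, ?_⟩, ?_⟩
      · rw [div_le_one (by positivity)]
        linarith
      · have : 2 * Real.pi * (z.arg / (2 * Real.pi)) = z.arg := by field_simp
        simp only [this, and_self]
    · refine ⟨⟨(z.arg + 2 * Real.pi) / (2 * Real.pi), ?_, ?_⟩, ?_⟩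
      · have : 0 ≤ z.arg + 2 * Real.pi := by linarith
        positivity
      · rw [div_le_one (by positivity)]
        linarith
      · have : 2 * Real.pi * ((z.arg + 2 * Real.pi) / (2 * Real.pi)) = z.arg + 2 * Real.pi := by
          field_simp
        simp only [this, Real.cos_add_two_pi, Real.sin_add_two_pi, and_self]
  refine ⟨θ, ⟨‖c‖, norm_nonneg c, hc⟩, ?_⟩
  have hu : ![Real.cos (2 * Real.pi * θ), Real.sin (2 * Real.pi * θ)] = ‖z‖⁻¹ • c := by
    rw [hcos, hsin, Complex.cos_arg hz, Complex.sin_arg]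
    funext i
    fin_cases i
    · simp [z, div_eq_inv_mul]
    · simp [z, div_eq_inv_mul]
  have hz' : (0 : ℝ) < ‖z‖ := norm_pos_iff.2 hz
  have hc' : (0 : ℝ) < ‖c‖ := norm_pos_iff.2 h0
  rw [squareBoundary, hu, norm_smul, norm_inv, norm_norm, smul_smul, smul_smul]
  convert one_smul ℝ c using 2
  field_simp

end Polar

/-! ### Cell structures from CW complexes and their quotients -/

section Construction

variable {X : Type*} [TopologicalSpace X] [CWComplex (Set.univ : Set X)]

/-- The point of a face with given polar coordinates. -/
def facePoint (p : Face X) (x : I × I) : X :=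
  RelCWComplex.map (C := (Set.univ : Set X)) 2 p ((x.2 : ℝ) • squareBoundary x.1)

theorem continuous_facePoint (p : Face X) : Continuous (facePoint p) := by
  refine (RelCWComplex.continuousOn (C := (Set.univ : Set X)) 2 p).comp_continuous
    ((continuous_subtype_val.comp continuous_snd).smul
      (continuous_squareBoundary.comp (continuous_subtype_val.comp continuous_fst))) fun x => ?_
  rw [mem_closedBall_zero_iff, norm_smul_squareBoundary]
  exact x.2.2.2

theorem facePoint_mem_openCell (p : Face X) {θ ρ : I} (h : ρ < 1) :
    facePoint p (θ, ρ) ∈ RelCWComplex.openCell (C := (Set.univ : Set X)) 2 p :=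
  ⟨_, by rw [mem_ball_zero_iff, norm_smul_squareBoundary]; exact h, rfl⟩

theorem vertexPoint_mem_openCell (v : Vertex X) :
    vertexPoint v ∈ RelCWComplex.openCell (C := (Set.univ : Set X)) 0 v := by
  rw [RelCWComplex.openCell_zero_eq_singleton]
  rfl

theorem cell_eq_of_mem_openCell {n m : ℕ} {i : RelCWComplex.cell (Set.univ : Set X) n}
    {j : RelCWComplex.cell (Set.univ : Set X) m} {x : X}
    (hi : x ∈ RelCWComplex.openCell (C := (Set.univ : Set X)) n i)
    (hj : x ∈ RelCWComplex.openCell (C := (Set.univ : Set X)) m j) :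
    (⟨n, i⟩ : Σ n, RelCWComplex.cell (Set.univ : Set X) n) = ⟨m, j⟩ :=
  RelCWComplex.eq_of_not_disjoint_openCell fun h => Set.disjoint_left.1 h hi hj

theorem vertexPoint_injective : Function.Injective (vertexPoint (X := X)) := fun v w h => by
  have := cell_eq_of_mem_openCell (vertexPoint_mem_openCell v) (h ▸ vertexPoint_mem_openCell w)
  simpa using this

theorem facePoint_zero (p : Face X) (θ : I) : facePoint p (θ, 0) = facePoint p (0, 0) := by
  simp [facePoint]

theorem facePoint_loop (p : Face X) (ρ : I) : facePoint p (0, ρ) = facePoint p (1, ρ) := by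
  simp [facePoint, squareBoundary_zero_eq_one]

theorem facePoint_inj {p p' : Face X} {θ ρ θ' ρ' : I} (h : ρ < 1) (h' : ρ' < 1)
    (heq : facePoint p (θ, ρ) = facePoint p' (θ', ρ')) :
    p = p' ∧ ρ = ρ' ∧ (ρ = 0 ∨ θ = θ' ∨ (θ = 0 ∧ θ' = 1) ∨ (θ = 1 ∧ θ' = 0)) := by
  have := cell_eq_of_mem_openCell (facePoint_mem_openCell p h)
    (heq ▸ facePoint_mem_openCell p' h')
  obtain rfl : p = p' := by simpa using this
  have hinj := (RelCWComplex.map (C := (Set.univ : Set X)) 2 p).injOn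
  rw [RelCWComplex.source_eq] at hinj
  have hv := hinj (by rw [mem_ball_zero_iff, norm_smul_squareBoundary]; exact h)
    (by rw [mem_ball_zero_iff, norm_smul_squareBoundary]; exact h') heq
  have hρ : ρ = ρ' := by
    have := congrArg norm hv
    rw [norm_smul_squareBoundary, norm_smul_squareBoundary] at this
    exact Subtype.ext this
  subst hρ
  refine ⟨rfl, rfl, ?_⟩
  by_cases h0 : ρ = 0
  · exact Or.inl h0
  · refine Or.inr (squareBoundary_inj (smul_right_injective _ ?_ hv))
    exact fun h => h0 (Subtype.ext h)

theorem closedCell_two_eq (p : Face X) :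
    RelCWComplex.closedCell (C := (Set.univ : Set X)) 2 p = Set.range (facePoint p) := by
  ext x
  constructor
  · rintro ⟨c, hc, rfl⟩
    obtain ⟨θ, ρ, h⟩ := exists_smul_squareBoundary (mem_closedBall_zero_iff.1 hc)
    exact ⟨(θ, ρ), congrArg _ h⟩
  · rintro ⟨x, rfl⟩
    refine ⟨_, ?_, rfl⟩
    rw [mem_closedBall_zero_iff, norm_smul_squareBoundary]
    exact x.2.2.2

variable [T2Space X]

/-- The point of an edge at a given parameter. -/
def edgePoint (e : Edge X) (s : I) : X := (edgeCurve e s).1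

theorem continuous_edgePoint (e : Edge X) : Continuous (edgePoint e) :=
  continuous_subtype_val.comp (edgeCurve e).continuous

theorem edgePoint_zero (e : Edge X) : edgePoint e 0 = vertexPoint (source e) :=
  congrArg Subtype.val (edgeCurve e).source

theorem edgePoint_one (e : Edge X) : edgePoint e 1 = vertexPoint (target e) :=
  congrArg Subtype.val (edgeCurve e).target

theorem edgeParameter_mem_ball {s : I} (hs : s ∈ Set.Ioo (0 : I) 1) :
    (fun _ => 2 * (s : ℝ) - 1 : Fin 1 → ℝ) ∈ Metric.ball (0 : Fin 1 → ℝ) 1 := by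
  have h0 : (0 : ℝ) < s := hs.1
  have h1 : (s : ℝ) < 1 := hs.2
  rw [mem_ball_zero_iff, pi_norm_lt_iff zero_lt_one]
  intro _
  rw [Real.norm_eq_abs, abs_lt]
  constructor <;> linarith

theorem edgePoint_mem_openCell (e : Edge X) {s : I} (hs : s ∈ Set.Ioo (0 : I) 1) :
    edgePoint e s ∈ RelCWComplex.openCell (C := (Set.univ : Set X)) 1 e :=
  ⟨_, edgeParameter_mem_ball hs, rfl⟩

theorem edgePoint_notMem_range (e : Edge X) {s : I} (hs : s ∈ Set.Ioo (0 : I) 1) :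
    edgePoint e s ∉ Set.range (vertexPoint (X := X)) := by
  rintro ⟨v, hv⟩
  have := cell_eq_of_mem_openCell (hv ▸ vertexPoint_mem_openCell v) (edgePoint_mem_openCell e hs)
  simp at this

theorem edgePoint_inj {e e' : Edge X} {s s' : I} (hs : s ∈ Set.Ioo (0 : I) 1)
    (hs' : s' ∈ Set.Ioo (0 : I) 1) (h : edgePoint e s = edgePoint e' s') : e = e' ∧ s = s' := by
  have := cell_eq_of_mem_openCell (edgePoint_mem_openCell e hs) (h ▸ edgePoint_mem_openCell e' hs')
  obtain rfl : e = e' := by simpa using this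
  refine ⟨rfl, Subtype.ext ?_⟩
  have hinj := (RelCWComplex.map (C := (Set.univ : Set X)) 1 e).injOn
  rw [RelCWComplex.source_eq] at hinj
  have := congrFun (hinj (edgeParameter_mem_ball hs) (edgeParameter_mem_ball hs') h) 0
  linarith

theorem mem_oneSkeleton_iff {x : X} :
    x ∈ (RelCWComplex.skeleton (Set.univ : Set X) 1 : Set X) ↔
      x ∈ Set.range (vertexPoint (X := X)) ∪ ⋃ e, Set.range (edgePoint (X := X) e) := by
  constructor
  · intro hx
    obtain ⟨m, hm, j, hj⟩ := CWComplex.mem_skeleton_iff.1 hx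
    have hm' : m ≤ 1 := by exact_mod_cast hm
    obtain rfl | rfl : m = 0 ∨ m = 1 := by omega
    · rw [RelCWComplex.openCell_zero_eq_singleton] at hj
      exact Or.inl ⟨j, (Set.mem_singleton_iff.1 hj).symm⟩
    · obtain ⟨c, hc, rfl⟩ := hj
      rw [mem_ball_zero_iff, pi_norm_lt_iff zero_lt_one] at hc
      have hc0 := abs_lt.1 (hc 0)
      refine Or.inr (Set.mem_iUnion.2 ⟨j, ⟨(c 0 + 1) / 2, by linarith, by linarith⟩, ?_⟩)
      change RelCWComplex.map (C := (Set.univ : Set X)) 1 j _ = _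
      congr 1
      funext i
      rw [Subsingleton.elim i 0]
      dsimp only
      ring
  · rintro (⟨v, rfl⟩ | hx)
    · exact (skeletonPoint v).2
    · obtain ⟨e, s, rfl⟩ := Set.mem_iUnion.1 hx
      exact (edgeCurve e s).2

theorem facePoint_one_eq (p : Face X) (θ : I) : facePoint p (θ, 1) = (attachingPoint p θ).1 := by
  simp [facePoint, attachingPoint]

theorem facePoint_notMem_skeleton (p : Face X) {θ ρ : I} (h : ρ < 1) :
    facePoint p (θ, ρ) ∉ (RelCWComplex.skeleton (Set.univ : Set X) 1 : Set X) := fun hx =>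
  Set.disjoint_left.1 (RelCWComplex.disjoint_skeleton_openCell
    (by norm_num : (1 : ℕ∞) < ((2 : ℕ) : ℕ∞))) hx (facePoint_mem_openCell p h)

theorem closedCell_one_eq (e : Edge X) :
    RelCWComplex.closedCell (C := (Set.univ : Set X)) 1 e = Set.range (edgePoint e) := by
  ext x
  constructor
  · rintro ⟨c, hc, rfl⟩
    rw [mem_closedBall_zero_iff, pi_norm_le_iff_of_nonneg zero_le_one] at hc
    have hc0 := abs_le.1 (hc 0)
    refine ⟨⟨(c 0 + 1) / 2, by linarith, by linarith⟩, ?_⟩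
    change RelCWComplex.map (C := (Set.univ : Set X)) 1 e _ = _
    congr 1
    funext i
    rw [Subsingleton.elim i 0]
    dsimp only
    ring
  · rintro ⟨s, rfl⟩
    refine ⟨fun _ => 2 * (s : ℝ) - 1, ?_, rfl⟩
    rw [mem_closedBall_zero_iff, pi_norm_le_iff_of_nonneg zero_le_one]
    intro _
    rw [Real.norm_eq_abs, abs_le]
    constructor <;> linarith [s.2.1, s.2.2]

theorem mem_skeleton_or_exists_facePoint
    (hdim : ∀ n : ℕ, 3 ≤ n → IsEmpty (RelCWComplex.cell (Set.univ : Set X) n)) (x : X) :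
    x ∈ (RelCWComplex.skeleton (Set.univ : Set X) 1 : Set X) ∨
      ∃ p θ ρ, ρ < 1 ∧ facePoint (X := X) p (θ, ρ) = x := by
  have hx : x ∈ ⋃ (n : ℕ) (j : RelCWComplex.cell (Set.univ : Set X) n),
      RelCWComplex.openCell (C := (Set.univ : Set X)) n j := by
    rw [CWComplex.iUnion_openCell_eq_complex]
    trivial
  obtain ⟨n, j, hj⟩ := Set.mem_iUnion₂.1 hx
  rcases Nat.lt_or_ge n 3 with hn | hn
  · by_cases h2 : n = 2
    · subst h2
      obtain ⟨c, hc, rfl⟩ := hj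
      rw [mem_ball_zero_iff] at hc
      obtain ⟨θ, ρ, rfl⟩ := exists_smul_squareBoundary hc.le
      rw [norm_smul_squareBoundary] at hc
      exact Or.inr ⟨j, θ, ρ, hc, rfl⟩
    · have hn1 : n ≤ 1 := by omega
      exact Or.inl (CWComplex.mem_skeleton_iff.2 ⟨n, by exact_mod_cast hn1, j, hj⟩)
  · exact ((hdim n hn).false j).elim

/-- The cell structure of a quotient of a 2-dimensional CW complex which identifies vertices only. -/
def quotientCellStructure
    (hdim : ∀ n : ℕ, 3 ≤ n → IsEmpty (RelCWComplex.cell (Set.univ : Set X) n))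
    {Z : Type*} [TopologicalSpace Z] (q : C(X, Z)) (hq : IsQuotientMap q)
    (hinj : ∀ x x', q x = q x' → x = x' ∨ x ∈ Set.range (vertexPoint (X := X)) ∧
      x' ∈ Set.range (vertexPoint (X := X))) : CellStructure Z (Edge X) (Face X) :=
  have hskel : q '' Set.range (vertexPoint (X := X)) ∪ ⋃ e : Edge X, Set.range (q ∘ edgePoint e) =
      q '' (RelCWComplex.skeleton (Set.univ : Set X) 1 : Set X) := by
    have : (RelCWComplex.skeleton (Set.univ : Set X) 1 : Set X) = _ :=
      Set.ext fun x => mem_oneSkeleton_iff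
    rw [this, Set.image_union, Set.image_iUnion]
    simp only [Set.range_comp]
  have hpre : q ⁻¹' (q '' (RelCWComplex.skeleton (Set.univ : Set X) 1 : Set X)) ⊆
      (RelCWComplex.skeleton (Set.univ : Set X) 1 : Set X) := by
    rintro x ⟨x', hx', h⟩
    rcases hinj _ _ h with rfl | ⟨-, h2⟩
    · exact hx'
    · exact mem_oneSkeleton_iff.2 (Or.inl h2)
  -- Closedness in `Z` is tested on preimages in `X`, and there on closed cells. These are images of
  -- compact parameter spaces in the Hausdorff space `X`, so `Z` itself needs no separation axiom.
  have hclosed1 : ∀ (A : Set Z) (e : Edge X), IsClosed ((q ∘ edgePoint e) ⁻¹' A) →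
      IsClosed (q ⁻¹' A ∩ RelCWComplex.closedCell (C := (Set.univ : Set X)) 1 e) := by
    intro A e h
    rw [closedCell_one_eq, ← Set.image_preimage_eq_inter_range]
    exact (h.isCompact.image (continuous_edgePoint e)).isClosed
  { verts := q '' Set.range (vertexPoint (X := X))
    edge := fun e => ⟨q ∘ edgePoint e, q.continuous.comp (continuous_edgePoint e)⟩
    face := fun p => ⟨q ∘ facePoint p, q.continuous.comp (continuous_facePoint p)⟩
    edge_zero_mem := fun e => ⟨_, ⟨_, rfl⟩, congrArg q (edgePoint_zero e).symm⟩
    edge_one_mem := fun e => ⟨_, ⟨_, rfl⟩, congrArg q (edgePoint_one e).symm⟩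
    edge_notMem := by
      rintro e s hs ⟨x, hx, h⟩
      rcases hinj _ _ h with rfl | ⟨-, h2⟩
      exacts [edgePoint_notMem_range e hs hx, edgePoint_notMem_range e hs h2]
    edge_inj := fun e s e' s' hs hs' h => by
      rcases hinj _ _ h with h1 | ⟨h1, -⟩
      exacts [edgePoint_inj hs hs' h1, (edgePoint_notMem_range e hs h1).elim]
    face_zero := fun p θ => congrArg q (facePoint_zero p θ)
    face_loop := fun p ρ => congrArg q (facePoint_loop p ρ)
    face_one_mem := fun p θ => by
      have : q (facePoint p (θ, 1)) ∈ q '' (RelCWComplex.skeleton (Set.univ : Set X) 1 : Set X) :=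
        Set.mem_image_of_mem q (facePoint_one_eq p θ ▸ (attachingPoint p θ).2)
      rw [← hskel] at this
      exact this
    face_notMem := fun p θ ρ h hx => by
      have : q (facePoint p (θ, ρ)) ∈ q '' (RelCWComplex.skeleton (Set.univ : Set X) 1 : Set X) := by
        rw [← hskel]
        exact hx
      exact facePoint_notMem_skeleton p h (hpre this)
    face_inj := fun p θ ρ p' θ' ρ' h h' heq => by
      rcases hinj _ _ heq with h1 | ⟨h1, -⟩
      exacts [facePoint_inj h h' h1, (facePoint_notMem_skeleton p h
        (mem_oneSkeleton_iff.2 (Or.inl h1))).elim]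
    cover := fun z hz => by
      obtain ⟨x, rfl⟩ := hq.surjective z
      rcases mem_skeleton_or_exists_facePoint hdim x with h | ⟨p, θ, ρ, h, rfl⟩
      · refine (hz ?_).elim
        have := Set.mem_image_of_mem q h
        rw [← hskel] at this
        exact this
      · exact ⟨p, θ, ρ, h, rfl⟩
    isClosed_of_subset := fun A hA he => by
      have hA' : A ⊆ q '' (RelCWComplex.skeleton (Set.univ : Set X) 1 : Set X) := hskel ▸ hA
      rw [← hq.isClosed_preimage]
      refine CWComplex.isClosed_of_disjoint_openCell_or_isClosed_inter_closedCell
        (C := (Set.univ : Set X)) (Set.subset_univ _) fun n hn j => ?_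
      rcases Nat.lt_or_ge 1 n with h | h
      -- A subset of the 1-skeleton misses all open cells of higher dimension, so only edges have to
      -- be tested.
      · refine Or.inl ((RelCWComplex.disjoint_skeleton_openCell (n := 1)
          (by exact_mod_cast h)).mono_left ?_)
        exact (Set.preimage_mono hA').trans hpre
      · obtain rfl : n = 1 := by omega
        exact Or.inr (hclosed1 A j (he j))
    isClosed_of := fun A he hf => by
      rw [← hq.isClosed_preimage]
      refine CWComplex.isClosed_of_disjoint_openCell_or_isClosed_inter_closedCell
        (C := (Set.univ : Set X)) (Set.subset_univ _) fun n hn j => Or.inr ?_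
      rcases Nat.lt_or_ge n 3 with h | h
      · obtain rfl | rfl : n = 1 ∨ n = 2 := by omega
        · exact hclosed1 A j (he j)
        · rw [closedCell_two_eq, ← Set.image_preimage_eq_inter_range]
          exact ((hf j).isCompact.image (continuous_facePoint j)).isClosed
      · exact ((hdim n h).false j).elim }

end Construction

namespace CellStructure

/-- The circle of radius `ρ` in a face is null-homotopic, so that it has trivial transport. -/
theorem arc_boundary_eq_one {Z E F H : Type*} [TopologicalSpace Z] [Group H]
    (K : CellStructure Z E F) (T : Transport Z H) (p : F) :
    T.arc ((K.face p).comp ((ContinuousMap.id I).prodMk (.const I 1))) 0 1 = 1 := by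
  have h0 : T.arc (K.face p) (0, 0) (1, 0) = 1 := by
    have h1 := T.arc_comp (K.face p) ((ContinuousMap.id I).prodMk (.const I 0)) 0 1
    have h2 : (K.face p).comp ((ContinuousMap.id I).prodMk (.const I 0)) =
        .const I (K.face p (0, 0)) := ContinuousMap.ext fun θ => K.face_zero p θ
    rw [h2, T.arc_const] at h1
    exact h1.symm
  have h1 : T.arc (K.face p) (0, 0) (0, 1) = T.arc (K.face p) (1, 0) (1, 1) := by
    have h1 := T.arc_comp (K.face p) ((ContinuousMap.const I 0).prodMk (.id I)) 0 1
    have h2 := T.arc_comp (K.face p) ((ContinuousMap.const I 1).prodMk (.id I)) 0 1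
    have h3 : (K.face p).comp ((ContinuousMap.const I 0).prodMk (.id I)) =
        (K.face p).comp ((ContinuousMap.const I 1).prodMk (.id I)) :=
      ContinuousMap.ext fun ρ => K.face_loop p ρ
    rw [h3] at h1
    exact h1.symm.trans h2
  -- The side `ρ = 1` of the square is traded for the other three: the side `ρ = 0` is constant, and
  -- the sides `θ = 0` and `θ = 1` have the same image in opposite directions.
  rw [T.arc_comp]
  change T.arc (K.face p) (0, 1) (1, 1) = 1
  rw [← T.arc_mul _ (0, 1) (0, 0), ← T.arc_mul _ (0, 0) (1, 0), h0, one_mul, ← h1, T.arc_mul,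
    T.arc_self]

end CellStructure

/-! ### Edge paths, holonomy and boundary words -/

section EdgePath

variable {X : Type*} [TopologicalSpace X] [CWComplex (Set.univ : Set X)]

namespace EdgePath

/-- The concatenation of two edge paths. -/
def append : {u v w : Vertex X} → EdgePath u v → EdgePath v w → EdgePath u w
  | _, _, _, .nil _, δ => δ
  | _, _, _, .cons d γ, δ => .cons d (γ.append δ)

/-- An edge, traversed along its orientation, as an edge path. -/
def single (e : Edge X) : EdgePath (source e) (target e) :=
  .cons (e, true) (.nil (target e))

/-- An edge, traversed against its orientation, as an edge path. -/
def singleReverse (e : Edge X) : EdgePath (target e) (source e) :=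
  .cons (e, false) (.nil (source e))

variable {G : Type*} [Group G] (a : Configuration X G)

theorem holonomy_append {u v w : Vertex X} (γ : EdgePath u v) (δ : EdgePath v w) :
    (γ.append δ).holonomy a = γ.holonomy a * δ.holonomy a := by
  induction γ with
  | nil v => exact (one_mul _).symm
  | cons d γ ih => exact (congrArg _ (ih δ)).trans (mul_assoc _ _ _).symm

theorem holonomy_single (e : Edge X) : (single e).holonomy a = a e :=
  mul_one _

theorem holonomy_singleReverse (e : Edge X) : (singleReverse e).holonomy a = (a e)⁻¹ :=
  mul_one _

theorem exists_reverse (G : Type*) [Group G] {u v : Vertex X} (γ : EdgePath u v) :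
    ∃ δ : EdgePath v u, ∀ a : Configuration X G, δ.holonomy a = (γ.holonomy a)⁻¹ := by
  induction γ with
  | nil v => exact ⟨.nil v, fun a => inv_one.symm⟩
  | cons d γ ih =>
    obtain ⟨δ, hδ⟩ := ih
    obtain ⟨e, _ | _⟩ := d
    · refine ⟨δ.append (single e), fun a => (holonomy_append a δ (single e)).trans
        ((congrArg₂ (· * ·) (hδ a) (holonomy_single a e)).trans ?_)⟩
      exact (mul_inv_rev (a e)⁻¹ _).trans (congrArg _ (inv_inv _)) |>.symm
    · exact ⟨δ.append (singleReverse e), fun a => (holonomy_append a δ (singleReverse e)).trans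
        ((congrArg₂ (· * ·) (hδ a) (holonomy_singleReverse a e)).trans (mul_inv_rev (a e) _).symm)⟩

/-- The gauge factors at the intermediate vertices cancel, also for edges traversed backwards. -/
theorem holonomy_gauge {h : Vertex X → G} {a b : Configuration X G}
    (hb : ∀ e, b e = h (source e) * a e * (h (target e))⁻¹) {u v : Vertex X} (γ : EdgePath u v) :
    γ.holonomy b = h u * γ.holonomy a * (h v)⁻¹ := by
  induction γ with
  | nil v => simp [holonomy]
  | cons d γ ih =>
    change d.value b * γ.holonomy b = _ * (d.value a * γ.holonomy a) * _
    rw [ih]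
    obtain ⟨e, _ | _⟩ := d
    · change (b e)⁻¹ * (h (source e) * _ * _) = h (target e) * ((a e)⁻¹ * _) * _
      rw [hb]
      group
    · change b e * (h (target e) * _ * _) = h (source e) * (a e * _) * _
      rw [hb]
      group

end EdgePath

variable [T2Space X]

theorem transport_curve {H : Type*} [Group H] (S : Transport (OneSkeleton X) H)
    {a : Configuration X H} (h : ∀ e, S.arc (edgeCurve e).toContinuousMap 0 1 = a e)
    {v w : Vertex X} (γ : EdgePath v w) :
    S.toFun (Path.Homotopic.Quotient.mk γ.curve) = γ.holonomy a := by
  induction γ with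
  | nil v => exact S.map_refl _
  | cons d γ ih =>
    change S.toFun (Path.Homotopic.Quotient.mk (d.curve.trans γ.curve)) =
      d.value a * γ.holonomy a
    rw [Path.Homotopic.Quotient.mk_trans, S.map_trans, ih]
    congr 1
    obtain ⟨e, _ | _⟩ := d
    · refine (S.map_symm (Path.Homotopic.Quotient.mk (edgeCurve e))).trans ?_
      rw [S.toFun_mk, h]
      rfl
    · refine (S.toFun_mk (edgeCurve e)).trans (h e)

/-- Freely homotopic loops have conjugate values, and triviality is insensitive to conjugation. -/
theorem BoundaryWord.transport_eq_one_iff {H : Type*} [Group H]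
    (S : Transport (OneSkeleton X) H) {a : Configuration X H}
    (h : ∀ e, S.arc (edgeCurve e).toContinuousMap 0 1 = a e) {p : Face X} (b : BoundaryWord p) :
    S.arc (attachingLoop p).toContinuousMap 0 1 = 1 ↔ b.path.holonomy a = 1 := by
  obtain ⟨c, hc⟩ := b.homotopic
  rw [← S.toFun_mk, Path.Homotopic.Quotient.eq.2 hc, Path.Homotopic.Quotient.mk_trans,
    Path.Homotopic.Quotient.mk_trans, S.map_trans, S.map_trans, transport_curve S h,
    Path.Homotopic.Quotient.mk_symm, S.map_symm]
  exact conj_eq_one_iff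

/-- An edge as a path in the complex. -/
def edgeMap (e : Edge X) : C(I, X) := ⟨edgePoint e, continuous_edgePoint e⟩

variable (X) in
/-- The inclusion of the 1-skeleton. -/
def skeletonInclusion : C(OneSkeleton X, X) := ⟨Subtype.val, continuous_subtype_val⟩

section Quotient

variable {Z : Type*} [TopologicalSpace Z] (q : C(X, Z)) {H : Type*} [Group H]
    {a : Configuration X H}

theorem transport_map_curve {T : Transport Z H} (hT : ∀ e, T.arc (q.comp (edgeMap e)) 0 1 = a e)
    {v w : Vertex X} (γ : EdgePath v w) :
    T.toFun ((Path.Homotopic.Quotient.mk γ.curve).map (q.comp (skeletonInclusion X))) =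
      γ.holonomy a :=
  transport_curve (T.comap (q.comp (skeletonInclusion X)))
    (fun e => (T.comap_arc _ _ _ _).trans (hT e)) γ

theorem holonomy_eq_one_of_transport
    (hdim : ∀ n : ℕ, 3 ≤ n → IsEmpty (RelCWComplex.cell (Set.univ : Set X) n))
    (hq : IsQuotientMap q)
    (hinj : ∀ x x', q x = q x' → x = x' ∨ x ∈ Set.range (vertexPoint (X := X)) ∧
      x' ∈ Set.range (vertexPoint (X := X))) {T : Transport Z H}
    (hT : ∀ e, T.arc (q.comp (edgeMap e)) 0 1 = a e) {p : Face X} (b : BoundaryWord p) :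
    b.path.holonomy a = 1 := by
  rw [← b.transport_eq_one_iff (T.comap (q.comp (skeletonInclusion X)))
    (fun e => (T.comap_arc _ _ _ _).trans (hT e)), T.comap_arc,
    ← (quotientCellStructure hdim q hq hinj).arc_boundary_eq_one T p]
  congr 1
  refine ContinuousMap.ext fun θ => congrArg q (facePoint_one_eq p θ).symm

/-- `CellStructure.exists_transport` asks for flatness along the boundaries in the 1-skeleton of
`Z`, whereas boundary words are homotopic to the attaching maps in that of `X`. The map `g` between
the two 1-skeleta transfers the condition. -/
theorem exists_transport_of_holonomy_eq_one
    (hdim : ∀ n : ℕ, 3 ≤ n → IsEmpty (RelCWComplex.cell (Set.univ : Set X) n))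
    (hq : IsQuotientMap q)
    (hinj : ∀ x x', q x = q x' → x = x' ∨ x ∈ Set.range (vertexPoint (X := X)) ∧
      x' ∈ Set.range (vertexPoint (X := X)))
    (bdry : ∀ p : Face X, BoundaryWord p)
    (h : ∀ p, (bdry p).path.holonomy a = 1) :
    ∃ T : Transport Z H, ∀ e, T.arc (q.comp (edgeMap e)) 0 1 = a e := by
  let K := quotientCellStructure hdim q hq hinj
  obtain ⟨T₁, hT₁, hT⟩ := K.exists_transport a
  have hg : ∀ x : OneSkeleton X, q x.1 ∈ K.skel := fun x => by
    rcases mem_oneSkeleton_iff.1 x.2 with hx | hx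
    · exact Or.inl (Set.mem_image_of_mem q hx)
    · obtain ⟨e, s, hs⟩ := Set.mem_iUnion.1 hx
      exact Or.inr (Set.mem_iUnion.2 ⟨e, s, congrArg q hs⟩)
  let g : C(OneSkeleton X, K.skel) := ⟨fun x => ⟨q x.1, hg x⟩,
    (q.continuous.comp continuous_subtype_val).subtype_mk hg⟩
  refine hT fun p => ?_
  rw [← ((bdry p).transport_eq_one_iff (T₁.comap g)
    (fun e => (T₁.comap_arc _ _ _ _).trans (hT₁ e))).2 (h p), T₁.comap_arc]
  congr 1
  exact ContinuousMap.ext fun θ => Subtype.ext (congrArg q (facePoint_one_eq p θ))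

end Quotient

end EdgePath

/-! ### Edge connectivity and gauge fixing -/

section Connectivity

variable {X : Type*} [TopologicalSpace X] [CWComplex (Set.univ : Set X)] [T2Space X]

/-- The cell structure of a CW complex of dimension at most 2. -/
def cellStructure (hdim : ∀ n : ℕ, 3 ≤ n → IsEmpty (RelCWComplex.cell (Set.univ : Set X) n)) :
    CellStructure X (Edge X) (Face X) :=
  quotientCellStructure hdim (ContinuousMap.id X) IsQuotientMap.id fun _ _ h => Or.inl h

theorem nonempty_edgePath [ConnectedSpace X]
    (hdim : ∀ n : ℕ, 3 ≤ n → IsEmpty (RelCWComplex.cell (Set.univ : Set X) n)) (u v : Vertex X) :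
    Nonempty (EdgePath u v) := by
  let A : Set X := vertexPoint '' {v | Nonempty (EdgePath u v)}
  have hmem : ∀ w, vertexPoint w ∈ A ↔ Nonempty (EdgePath u w) := fun w =>
    vertexPoint_injective.mem_set_image
  have hA := (cellStructure hdim).verts_subset_of_edge (A := A)
    (fun x hx => ⟨x, Set.image_subset_range _ _ hx, rfl⟩) ⟨_, u, ⟨.nil u⟩, rfl⟩ fun e => by
      change edgePoint e 0 ∈ A ↔ edgePoint e 1 ∈ A
      rw [edgePoint_zero, edgePoint_one, hmem, hmem]
      exact ⟨fun ⟨γ⟩ => ⟨γ.append (.single e)⟩, fun ⟨γ⟩ => ⟨γ.append (.singleReverse e)⟩⟩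
  exact (hmem v).1 (hA ⟨_, ⟨v, rfl⟩, rfl⟩)

theorem pathConnectedSpace_of_vertex [ConnectedSpace X]
    (hdim : ∀ n : ℕ, 3 ≤ n → IsEmpty (RelCWComplex.cell (Set.univ : Set X) n)) (v : Vertex X) :
    PathConnectedSpace X :=
  (cellStructure hdim).pathConnectedSpace (v := vertexPoint v) ⟨_, ⟨v, rfl⟩, rfl⟩

/-- Two configurations with the same holonomies between the vertices of a set differ by a gauge
transformation which is trivial on this set. -/
theorem exists_gauge_of_holonomy_eq [ConnectedSpace X]
    (hdim : ∀ n : ℕ, 3 ≤ n → IsEmpty (RelCWComplex.cell (Set.univ : Set X) n))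
    {Y : Set (Vertex X)} (hY : Y.Nonempty) {G : Type*} [Group G] {a b : Configuration X G}
    (h : ∀ v ∈ Y, ∀ w ∈ Y, ∀ γ : EdgePath v w, γ.holonomy a = γ.holonomy b) :
    ∃ d : Vertex X → G, (∀ v ∈ Y, d v = 1) ∧
      ∀ e, b e = d (source e) * a e * (d (target e))⁻¹ := by
  obtain ⟨y, hy⟩ := hY
  -- At a ghost vertex the chosen path is the empty one, which makes the gauge factor trivial there.
  have hpath : ∀ v, ∃ s ∈ Y, ∃ γ : EdgePath s v,
      v ∈ Y → γ.holonomy a = 1 ∧ γ.holonomy b = 1 := fun v => by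
    by_cases hv : v ∈ Y
    · exact ⟨v, hv, .nil v, fun _ => ⟨rfl, rfl⟩⟩
    · obtain ⟨γ⟩ := nonempty_edgePath hdim y v
      exact ⟨y, hy, γ, fun h => (hv h).elim⟩
  choose s hs γ hγ using hpath
  refine ⟨fun v => ((γ v).holonomy b)⁻¹ * (γ v).holonomy a, fun v hv => ?_, fun e => ?_⟩
  · simp [hγ v hv]
  -- The factor at the other end of `e` comes from comparing the holonomies along the path that
  -- reaches `e`, crosses it and returns to `Y`.
  · obtain ⟨δ, hδ⟩ := (γ (target e)).exists_reverse G
    have := h _ (hs _) _ (hs _) ((γ (source e)).append ((EdgePath.single e).append δ))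
    simp only [EdgePath.holonomy_append, EdgePath.holonomy_single, hδ] at this
    calc b e = ((γ (source e)).holonomy b)⁻¹ * ((γ (source e)).holonomy b *
          (b e * ((γ (target e)).holonomy b)⁻¹)) * (γ (target e)).holonomy b := by group
      _ = _ := by
        rw [← this]
        group

end Connectivity

/-! ### Holonomy homomorphisms on the quotient by the ghost vertices -/

section Ghost

variable {X : Type*} [TopologicalSpace X] [CWComplex (Set.univ : Set X)] (Y : Set (Vertex X))

/-- The projection from `X` to `X / Y`. -/
def ghostMap : C(X, GhostQuotient Y) := ⟨Quotient.mk (ghostSetoid Y), continuous_quotient_mk'⟩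

theorem isQuotientMap_ghostMap : IsQuotientMap (ghostMap Y) := isQuotientMap_quotient_mk'

theorem ghostMap_eq {x x' : X} (h : ghostMap Y x = ghostMap Y x') :
    x = x' ∨ x ∈ Set.range (vertexPoint (X := X)) ∧ x' ∈ Set.range (vertexPoint (X := X)) := by
  rcases Quotient.exact h with h | ⟨h, h'⟩
  · exact Or.inl h
  · exact Or.inr ⟨Set.image_subset_range _ _ h, Set.image_subset_range _ _ h'⟩

/-- A function of the vertices which is constant on the ghost vertices descends to the quotient. -/
theorem exists_comp_ghostPoint_eq {H : Type*} [One H] (d : Vertex X → H)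
    (hd : ∀ v ∈ Y, ∀ w ∈ Y, d v = d w) : ∃ d' : GhostQuotient Y → H, ∀ v, d' (ghostPoint Y v) = d v := by
  have hfac : Function.FactorsThrough d (ghostPoint Y) := fun v w h => by
    rcases Quotient.exact h with h | ⟨h, h'⟩
    · rw [vertexPoint_injective h]
    · exact hd v (vertexPoint_injective.mem_set_image.1 h) w
        (vertexPoint_injective.mem_set_image.1 h')
  exact ⟨Function.extend (ghostPoint Y) d 1, fun v => hfac.extend_apply 1 v⟩

variable [T2Space X]

/-- The cell structure of `X / Y`. -/
def ghostCellStructure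
    (hdim : ∀ n : ℕ, 3 ≤ n → IsEmpty (RelCWComplex.cell (Set.univ : Set X) n)) :
    CellStructure (GhostQuotient Y) (Edge X) (Face X) :=
  quotientCellStructure hdim (ghostMap Y) (isQuotientMap_ghostMap Y) fun _ _ h => ghostMap_eq Y h

variable {Y} {H : Type*} [Group H]

theorem hasHolonomy_toHom {T : Transport (GhostQuotient Y) H} {a : Configuration X H}
    (hT : ∀ e, T.arc ((ghostMap Y).comp (edgeMap e)) 0 1 = a e) {y : Vertex X} (hy : y ∈ Y) :
    HasHolonomy hy (T.toHom (ghostPoint Y y)) a := fun v w hv hw γ => by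
  rw [← transport_map_curve (ghostMap Y) hT γ, map_inv, T.toHom_apply, inv_inv]
  exact (T.map_cast _ (ghostPoint_eq hy hv) (ghostPoint_eq hy hw)).symm

theorem toHom_mapHom_tautologicalTransport {Z : Type*} [TopologicalSpace Z] {z : Z}
    {c : ∀ w : Z, Path.Homotopic.Quotient z w} (hc : c z = Path.Homotopic.Quotient.refl z)
    (φ : FundamentalGroup Z z →* H) : ((tautologicalTransport c).mapHom φ).toHom z = φ := by
  ext p
  change (φ ((tautologicalTransport c).toFun (FundamentalGroup.toPath p)))⁻¹ = φ p
  rw [tautologicalTransport_apply_loop hc, map_inv, inv_inv]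

theorem exists_choice {Z : Type*} [TopologicalSpace Z] [PathConnectedSpace Z] (z : Z) :
    ∃ c : ∀ w : Z, Path.Homotopic.Quotient z w, c z = Path.Homotopic.Quotient.refl z := by
  classical
  exact ⟨fun w => if h : w = z then (Path.Homotopic.Quotient.refl z).cast rfl h else
    Path.Homotopic.Quotient.mk (PathConnectedSpace.somePath z w), by simp⟩

theorem HasHolonomy.holonomy_eq {y : Vertex X} {hy : y ∈ Y}
    {φ : FundamentalGroup (GhostQuotient Y) (ghostPoint Y y) →* H} {a b : Configuration X H}
    (ha : HasHolonomy hy φ a) (hb : HasHolonomy hy φ b) :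
    ∀ v ∈ Y, ∀ w ∈ Y, ∀ γ : EdgePath v w, γ.holonomy a = γ.holonomy b := fun v hv w hw γ =>
  (ha v w hv hw γ).trans (hb v w hv hw γ).symm

variable [ConnectedSpace X] {y : Vertex X}

/-- Conjugating by chosen paths from the base point turns every path into a loop, on which `φ` is
defined; the choice is trivial at the base point, so that loops there are not changed. -/
theorem exists_transport_toHom_eq
    (hdim : ∀ n : ℕ, 3 ≤ n → IsEmpty (RelCWComplex.cell (Set.univ : Set X) n))
    (y : Vertex X) (φ : FundamentalGroup (GhostQuotient Y) (ghostPoint Y y) →* H) :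
    ∃ T : Transport (GhostQuotient Y) H, T.toHom _ = φ := by
  have := pathConnectedSpace_of_vertex hdim y
  obtain ⟨c, hc⟩ := exists_choice (ghostPoint Y y)
  exact ⟨_, toHom_mapHom_tautologicalTransport hc φ⟩

theorem exists_hasHolonomy
    (hdim : ∀ n : ℕ, 3 ≤ n → IsEmpty (RelCWComplex.cell (Set.univ : Set X) n))
    (hy : y ∈ Y) (φ : FundamentalGroup (GhostQuotient Y) (ghostPoint Y y) →* H) :
    ∃ a, HasHolonomy hy φ a := by
  obtain ⟨T, rfl⟩ := exists_transport_toHom_eq hdim y φ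
  exact ⟨_, hasHolonomy_toHom (fun e => rfl) hy⟩

/-- Both homomorphisms come from transports, whose edge labels have the same holonomies between
ghost vertices as `a`. These labels differ by a gauge transformation trivial on `Y`, which descends
to `X / Y`; hence the transports agree on loops at the base point. -/
theorem HasHolonomy.unique
    (hdim : ∀ n : ℕ, 3 ≤ n → IsEmpty (RelCWComplex.cell (Set.univ : Set X) n)) {hy : y ∈ Y}
    {φ φ' : FundamentalGroup (GhostQuotient Y) (ghostPoint Y y) →* H} {a : Configuration X H}
    (h : HasHolonomy hy φ a) (h' : HasHolonomy hy φ' a) : φ = φ' := by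
  obtain ⟨T, rfl⟩ := exists_transport_toHom_eq hdim y φ
  obtain ⟨T', rfl⟩ := exists_transport_toHom_eq hdim y φ'
  have hT := (hasHolonomy_toHom (fun e => rfl) hy : HasHolonomy hy (T.toHom _) _).holonomy_eq h
  have hT' := h'.holonomy_eq (hasHolonomy_toHom (fun e => rfl) hy)
  obtain ⟨d, hd, hgauge⟩ := exists_gauge_of_holonomy_eq hdim ⟨y, hy⟩ fun v hv w hw γ =>
    (hT v hv w hw γ).trans (hT' v hv w hw γ)
  obtain ⟨d', hd'⟩ := exists_comp_ghostPoint_eq Y (fun v => (d v)⁻¹) fun v hv w hw => by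
    rw [hd v hv, hd w hw]
  ext p
  have hmem : ghostPoint Y y ∈ (ghostCellStructure Y hdim).verts := ⟨_, ⟨y, rfl⟩, rfl⟩
  have := (ghostCellStructure Y hdim).gaugeRelated_of_edge T T' d' (fun e => by
    have h0 : (ghostCellStructure Y hdim).edge e 0 = ghostPoint Y (source e) :=
      congrArg (ghostMap Y) (edgePoint_zero e)
    have h1 : (ghostCellStructure Y hdim).edge e 1 = ghostPoint Y (target e) :=
      congrArg (ghostMap Y) (edgePoint_one e)
    rw [h0, h1, hd', hd', inv_inv]
    exact hgauge e) hmem hmem (FundamentalGroup.toPath p)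
  rw [T.toHom_apply, T'.toHom_apply, this, hd', hd y hy]
  simp

/-- A configuration has a holonomy homomorphism if and only if it satisfies all `Z`-checks. -/
theorem exists_hasHolonomy_iff
    (hdim : ∀ n : ℕ, 3 ≤ n → IsEmpty (RelCWComplex.cell (Set.univ : Set X) n))
    (bdry : ∀ p : Face X, BoundaryWord p) (hy : y ∈ Y) (a : Configuration X H) :
    (∃ φ, HasHolonomy hy φ a) ↔ ∀ p, (bdry p).path.holonomy a = 1 := by
  constructor
  · rintro ⟨φ, hφ⟩ p
    obtain ⟨T, rfl⟩ := exists_transport_toHom_eq hdim y φ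
    -- A boundary word need not touch `Y`, so `hφ` says nothing about it directly. The configuration
    -- of `T` is flat, and `a` is gauge equivalent to it, which conjugates the holonomy of closed
    -- edge paths.
    obtain ⟨d, hd, hgauge⟩ := exists_gauge_of_holonomy_eq hdim ⟨y, hy⟩
      ((hasHolonomy_toHom (fun e => rfl) hy : HasHolonomy hy (T.toHom _) _).holonomy_eq hφ)
    rw [EdgePath.holonomy_gauge hgauge, holonomy_eq_one_of_transport _ hdim
      (isQuotientMap_ghostMap Y) (fun _ _ h => ghostMap_eq Y h) (fun e => rfl)]
    simp
  · intro h
    obtain ⟨T, hT⟩ := exists_transport_of_holonomy_eq_one _ hdim (isQuotientMap_ghostMap Y)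
      (fun _ _ h => ghostMap_eq Y h) bdry h
    exact ⟨_, hasHolonomy_toHom hT hy⟩

end Ghost

/-! ### Gauge transformations of configurations -/

section Gauge

variable {X : Type*} [TopologicalSpace X] [CWComplex (Set.univ : Set X)] {G : Type*} [Group G]

open Classical in
theorem gaugeTransform_apply (v : Vertex X) (g : G) (a : Configuration X G) (e : Edge X) :
    gaugeTransform v g a e = (Pi.mulSingle v g : Vertex X → G) (source e) * a e *
      ((Pi.mulSingle v g : Vertex X → G) (target e))⁻¹ := by
  rw [gaugeTransform, Pi.mulSingle_apply, Pi.mulSingle_apply]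
  congr 1
  split_ifs <;> simp

theorem gaugeTransform_inv (v : Vertex X) (g : G) (a : Configuration X G) :
    gaugeTransform v g⁻¹ (gaugeTransform v g a) = a := by
  classical
  funext e
  rw [gaugeTransform_apply, gaugeTransform_apply, Pi.mulSingle_inv]
  simp only [Pi.inv_apply]
  group

theorem gaugeTransform_injective (v : Vertex X) (g : G) :
    Function.Injective (gaugeTransform (X := X) v g) :=
  Function.LeftInverse.injective (gaugeTransform_inv v g)

/-- A function of the configurations which is invariant under gauge transformations at the vertices
outside of a set is invariant under all gauge transformations which are trivial on the set. -/
theorem eq_of_gauge [Finite (Edge X)] {Y : Set (Vertex X)} {S : Type*} {f : Configuration X G → S}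
    (hf : ∀ v ∉ Y, ∀ g a, f (gaugeTransform v g a) = f a) {d : Vertex X → G}
    (hd : ∀ v ∈ Y, d v = 1) {a b : Configuration X G}
    (hb : ∀ e, b e = d (source e) * a e * (d (target e))⁻¹) : f b = f a := by
  classical
  have key : ∀ (s : Finset (Vertex X)) (d : Vertex X → G), (∀ v ∈ Y, d v = 1) →
      (∀ v ∉ s, d v = 1) → ∀ b : Configuration X G,
      (∀ e, b e = d (source e) * a e * (d (target e))⁻¹) → f b = f a := by
    intro s
    induction s using Finset.induction_on with
    | empty =>
      intro d _ hs b hb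
      congr 1
      funext e
      rw [hb, hs _ (Finset.notMem_empty _), hs _ (Finset.notMem_empty _)]
      simp
    | insert v s hv ih =>
      intro d hd hs b hb
      -- The value at `v` is split off as a single gauge transformation, which leaves one with
      -- smaller support.
      let d' := Function.update d v 1
      have hd' : ∀ w ∈ Y, d' w = 1 := fun w hw => by
        by_cases h : w = v
        · simp [d', h]
        · simp [d', h, hd w hw]
      have hs' : ∀ w ∉ s, d' w = 1 := fun w hw => by
        by_cases h : w = v
        · simp [d', h]
        · simp only [d', Function.update_of_ne h]
          exact hs w (by simp [h, hw])
      have hmul : ∀ w, d w = (Pi.mulSingle v (d v) : Vertex X → G) w * d' w := fun w => by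
        by_cases h : w = v
        · subst h
          simp [d']
        · simp [d', h]
      have hbv : b = gaugeTransform v (d v) (fun e => d' (source e) * a e * (d' (target e))⁻¹) := by
        funext e
        rw [hb, gaugeTransform_apply, hmul (source e), hmul (target e)]
        group
      rw [← ih d' hd' hs' _ fun e => rfl, hbv]
      by_cases hvY : v ∈ Y
      · rw [hd v hvY]
        congr 1
        funext e
        rw [gaugeTransform_apply]
        simp
      · exact hf v hvY _ _
  have := Fintype.ofFinite (Edge X)
  -- Only the ends of the finitely many edges matter; the gauge function may be replaced by `1`
  -- elsewhere.
  let s : Finset (Vertex X) := Finset.univ.image source ∪ Finset.univ.image target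
  refine key s (fun v => if v ∈ s then d v else 1) (fun v hv => by simp [hd v hv])
    (fun v hv => if_neg hv) b fun e => ?_
  rw [hb, if_pos (by simp [s]), if_pos (by simp [s])]

theorem HasHolonomy.gaugeTransform [T2Space X] {Y : Set (Vertex X)} {y : Vertex X} {hy : y ∈ Y}
    {φ : FundamentalGroup (GhostQuotient Y) (ghostPoint Y y) →* G} {a : Configuration X G}
    (h : HasHolonomy hy φ a) {v : Vertex X} (hv : v ∉ Y) (g : G) :
    HasHolonomy hy φ (gaugeTransform v g a) := fun u w hu hw γ => by
  classical
  rw [← h u w hu hw γ, EdgePath.holonomy_gauge (gaugeTransform_apply v g a),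
    Pi.mulSingle_eq_of_ne (ne_of_mem_of_not_mem hu hv),
    Pi.mulSingle_eq_of_ne (ne_of_mem_of_not_mem hw hv)]
  simp

end Gauge

/-! ### The codespace as a space of functions on configurations -/

section Codespace

variable {X : Type*} [TopologicalSpace X] [CWComplex (Set.univ : Set X)] {G : Type*} [Group G]

theorem xCheck_apply_eq_self_iff (v : Vertex X) (g : G) (ψ : PhysicalSpace X G) :
    xCheck v g ψ = ψ ↔ ∀ a, ψ (gaugeTransform v g a) = ψ a := by
  have h : ∀ a, (xCheck v g ψ : PhysicalSpace X G) (gaugeTransform v g a) = ψ a := fun a =>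
    Finsupp.mapDomain_apply (gaugeTransform_injective v g) ψ a
  constructor
  · intro hψ a
    rw [← h a, hψ]
  · intro hψ
    ext a
    have hinv := gaugeTransform_inv v g⁻¹ a
    rw [inv_inv] at hinv
    rw [← hinv, h, hψ]

open Classical in
theorem zCheck_apply {v : Vertex X} (γ : EdgePath v v) (ψ : PhysicalSpace X G)
    (a : Configuration X G) :
    (zCheck γ ψ : PhysicalSpace X G) a = if γ.holonomy a = 1 then ψ a else 0 := by
  induction ψ using Finsupp.induction_linear with
  | zero => simp
  | add ψ ψ' h h' =>
    rw [map_add, Finsupp.add_apply, h, h', Finsupp.add_apply]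
    split_ifs <;> simp
  | single b z =>
    rw [zCheck, Finsupp.linearCombination_single]
    by_cases hab : b = a
    · subst hab
      split_ifs <;> simp
    · have : (Finsupp.single b z : PhysicalSpace X G) a = 0 := Finsupp.single_eq_of_ne' hab
      rw [this, ite_self]
      split_ifs
      · simp [Finsupp.single_eq_of_ne' hab]
      · simp

/-- By `zCheck_apply`, the check multiplies `ψ` by the indicator function of trivial holonomy, so
fixed vectors are those with support in that set. -/
theorem zCheck_apply_eq_self_iff {v : Vertex X} (γ : EdgePath v v) (ψ : PhysicalSpace X G) :
    zCheck γ ψ = ψ ↔ ∀ a, ψ a ≠ 0 → γ.holonomy a = 1 := by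
  classical
  rw [Finsupp.ext_iff]
  refine forall_congr' fun a => ?_
  rw [zCheck_apply]
  split_ifs with h
  · simp [h]
  · simp [h, eq_comm]

theorem mem_codespace_iff [T2Space X] (bdry : ∀ p : Face X, BoundaryWord p) (Y : Set (Vertex X))
    (ψ : PhysicalSpace X G) :
    ψ ∈ codespace G bdry Y ↔ (∀ v ∉ Y, ∀ g a, ψ (gaugeTransform v g a) = ψ a) ∧
      ∀ p a, ψ a ≠ 0 → (bdry p).path.holonomy a = 1 := by
  simp only [codespace, Submodule.mem_inf, Submodule.mem_iInf, Module.End.mem_eigenspace_iff,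
    one_smul, xCheck_apply_eq_self_iff, zCheck_apply_eq_self_iff, Set.mem_compl_iff]

open Classical in
/-- The functions on a finite set which are supported on the domain of a surjective partial function
`r` and are constant on its fibres have as a basis the indicator functions of the fibres. -/
theorem exists_linearEquiv_of_fibres {A B : Type*} [Finite A] (r : B → A → Prop)
    (hr : ∀ φ φ' a, r φ a → r φ' a → φ = φ') (hr' : ∀ φ, ∃ a, r φ a)
    (C : Submodule ℂ (A →₀ ℂ)) (hC : ∀ ψ, ψ ∈ C ↔
      (∀ a b φ, r φ a → r φ b → ψ a = ψ b) ∧ ∀ a, ψ a ≠ 0 → ∃ φ, r φ a) :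
    ∃ Ψ : (B →₀ ℂ) ≃ₗ[ℂ] C, ∀ φ a,
      (Ψ (Finsupp.single φ 1) : A →₀ ℂ) a = if r φ a then 1 else 0 := by
  choose s hs using hr'
  have : Finite B := Finite.of_injective s fun φ φ' h => hr _ _ _ (hs φ) (h ▸ hs φ')
  let f : (B →₀ ℂ) → A →₀ ℂ := fun x => Finsupp.equivFunOnFinite.symm fun a =>
    if h : ∃ φ, r φ a then x h.choose else 0
  have hf : ∀ x φ a, r φ a → f x a = x φ := fun x φ a h => by
    have h' : ∃ φ, r φ a := ⟨φ, h⟩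
    simp only [f, Finsupp.coe_equivFunOnFinite_symm]
    rw [dif_pos h', hr _ _ _ h'.choose_spec h]
  have hf0 : ∀ x a, (¬ ∃ φ, r φ a) → f x a = 0 := fun x a h => by
    simp only [f, Finsupp.coe_equivFunOnFinite_symm]
    rw [dif_neg h]
  have hfC : ∀ x, f x ∈ C := fun x => (hC _).2
    ⟨fun a b φ ha hb => by rw [hf x φ a ha, hf x φ b hb], fun a ha => not_imp_comm.1 (hf0 x a) ha⟩
  let Ψ : (B →₀ ℂ) ≃ₗ[ℂ] C :=
    { toFun := fun x => ⟨f x, hfC x⟩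
      map_add' := fun x x' => Subtype.ext <| Finsupp.ext fun a => by
        by_cases h : ∃ φ, r φ a
        · obtain ⟨φ, h⟩ := h
          simp [hf _ φ a h]
        · simp [hf0 _ a h]
      map_smul' := fun z x => Subtype.ext <| Finsupp.ext fun a => by
        by_cases h : ∃ φ, r φ a
        · obtain ⟨φ, h⟩ := h
          simp [hf _ φ a h]
        · simp [hf0 _ a h]
      invFun := fun ψ => Finsupp.equivFunOnFinite.symm fun φ => (ψ : A →₀ ℂ) (s φ)
      left_inv := fun x => Finsupp.ext fun φ => hf x φ _ (hs φ)
      right_inv := fun ψ => Subtype.ext <| Finsupp.ext fun a => by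
        by_cases h : ∃ φ, r φ a
        · obtain ⟨φ, h⟩ := h
          refine (hf _ φ a h).trans ?_
          exact ((hC _).1 ψ.2).1 _ _ φ (hs φ) h
        · refine (hf0 _ a h).trans (not_not.1 fun h' => h (((hC _).1 ψ.2).2 a (Ne.symm h'))) }
  refine ⟨Ψ, fun φ a => ?_⟩
  change f _ a = _
  split_ifs with h
  · rw [hf _ φ a h, Finsupp.single_eq_same]
  · by_cases h' : ∃ φ, r φ a
    · obtain ⟨φ', h'⟩ := h'
      rw [hf _ φ' a h', Finsupp.single_eq_of_ne]
      rintro rfl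
      exact h h'
    · exact hf0 _ a h'

open Classical in
/-- The codespace has a basis which is indexed by the homomorphisms from the fundamental group of
the quotient by the ghost vertices. -/
theorem exists_codespace_equiv [T2Space X] [ConnectedSpace X]
    (hdim : ∀ n : ℕ, 3 ≤ n → IsEmpty (RelCWComplex.cell (Set.univ : Set X) n))
    [Finite (Edge X)] (bdry : ∀ p : Face X, BoundaryWord p) [Finite G] {Y : Set (Vertex X)}
    {y : Vertex X} (hy : y ∈ Y) :
    ∃ Ψ : ((FundamentalGroup (GhostQuotient Y) (ghostPoint Y y) →* G) →₀ ℂ)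
      ≃ₗ[ℂ] codespace G bdry Y,
      ∀ (φ : FundamentalGroup (GhostQuotient Y) (ghostPoint Y y) →* G) (a : Configuration X G),
        (Ψ (Finsupp.single φ 1) : PhysicalSpace X G) a = if HasHolonomy hy φ a then 1 else 0 := by
  refine exists_linearEquiv_of_fibres (HasHolonomy hy) (fun φ φ' a h h' => h.unique hdim h')
    (exists_hasHolonomy hdim hy) _ fun ψ => ?_
  rw [mem_codespace_iff]
  constructor
  · rintro ⟨hX, hZ⟩
    refine ⟨fun a b φ ha hb => ?_, fun a ha => ?_⟩
    · obtain ⟨d, hd, h⟩ := exists_gauge_of_holonomy_eq hdim ⟨y, hy⟩ (ha.holonomy_eq hb)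
      exact (eq_of_gauge hX hd h).symm
    · exact (exists_hasHolonomy_iff hdim bdry hy a).2 fun p => hZ p a ha
  · rintro ⟨hR, hS⟩
    refine ⟨fun v hv g a => ?_, fun p a ha => (exists_hasHolonomy_iff hdim bdry hy a).1 (hS a ha) p⟩
    by_cases h : ∃ φ, HasHolonomy hy φ a
    · obtain ⟨φ, h⟩ := h
      exact hR _ _ φ (h.gaugeTransform hv g) h
    -- The configurations without a holonomy are also stable under gauge transformations, and `ψ`
    -- vanishes on all of them.
    · have h' : ¬ ∃ φ, HasHolonomy hy φ (gaugeTransform v g a) := by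
        rintro ⟨φ, h'⟩
        have := h'.gaugeTransform hv g⁻¹
        rw [gaugeTransform_inv] at this
        exact h ⟨φ, this⟩
      rw [not_not.1 (mt (hS _) h), not_not.1 (mt (hS _) h')]

end Codespace

/-! ### The free product decomposition of the fundamental group -/

section FundamentalGroup

variable {X : Type*} [TopologicalSpace X] [CWComplex (Set.univ : Set X)] {Y : Set (Vertex X)}
  {y : Vertex X}

/-- The homomorphism of fundamental groups which is induced by the projection to `X / Y`. -/
def ghostHom (Y : Set (Vertex X)) (y : Vertex X) :
    FundamentalGroup X (vertexPoint y) →* FundamentalGroup (GhostQuotient Y) (ghostPoint Y y) :=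
  FundamentalGroup.map (ghostMap Y) (vertexPoint y)

/-- The induced homomorphism in terms of the tautological transports. -/
theorem ghostHom_tautologicalTransport {c : ∀ x : X, Path.Homotopic.Quotient (vertexPoint y) x}
    {c' : ∀ z, Path.Homotopic.Quotient (ghostPoint Y y) z}
    (hc' : c' (ghostPoint Y y) = Path.Homotopic.Quotient.refl _)
    {u v : X} (p : Path.Homotopic.Quotient u v) :
    ghostHom Y y ((tautologicalTransport c).toFun p) =
      ((tautologicalTransport c').comap (ghostMap Y)).toFun (c u) *
      ((tautologicalTransport c').comap (ghostMap Y)).toFun p *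
      (((tautologicalTransport c').comap (ghostMap Y)).toFun (c v))⁻¹ := by
  rw [← Transport.map_symm, ← Transport.map_trans, ← Transport.map_trans]
  refine Eq.trans ?_ (tautologicalTransport_apply_loop hc' _).symm
  exact map_inv (ghostHom Y y) _

variable [T2Space X] [ConnectedSpace X]

/-- The fundamental group of the quotient by the ghost vertices is the free product of the
fundamental group of the complex and a free group. -/
theorem nonempty_fundamentalGroup_ghostQuotient_mulEquiv
    (hdim : ∀ n : ℕ, 3 ≤ n → IsEmpty (RelCWComplex.cell (Set.univ : Set X) n))
    (bdry : ∀ p : Face X, BoundaryWord p) (hy : y ∈ Y) :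
    Nonempty (FundamentalGroup (GhostQuotient Y) (ghostPoint Y y) ≃*
      Monoid.Coprod (FundamentalGroup X (vertexPoint y)) (FreeGroup {v // v ∈ Y ∧ v ≠ y})) := by
  classical
  have := pathConnectedSpace_of_vertex hdim y
  obtain ⟨c, hc⟩ := exists_choice (vertexPoint y)
  obtain ⟨c', hc'⟩ := exists_choice (ghostPoint Y y)
  set S := tautologicalTransport c
  set S' := tautologicalTransport c'
  let K := Monoid.Coprod (FundamentalGroup X (vertexPoint y)) (FreeGroup {v // v ∈ Y ∧ v ≠ y})
  let inl : FundamentalGroup X (vertexPoint y) →* K := Monoid.Coprod.inl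
  let inr : FreeGroup {v // v ∈ Y ∧ v ≠ y} →* K := Monoid.Coprod.inr
  let t : Vertex X → K := fun v => if h : v ∈ Y ∧ v ≠ y then inr (.of ⟨v, h⟩) else 1
  have hty : t y = 1 := dif_neg fun h => h.2 rfl
  let b : Configuration X K := fun e => (S.mapHom inl).arc (edgeMap e) 0 1
  -- On `X` this is a mere gauge transformation of `b`, so flatness persists. As `t` is not constant
  -- on `Y`, it does not descend to the quotient as one: there the labels acquire holonomy `t v`
  -- along the chosen path from `y` to a ghost vertex `v`.
  let a : Configuration X K := fun e => (t (source e))⁻¹ * b e * t (target e)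
  obtain ⟨T, hT⟩ : ∃ T : Transport (GhostQuotient Y) K,
      ∀ e, T.arc ((ghostMap Y).comp (edgeMap e)) 0 1 = a e := by
    refine exists_transport_of_holonomy_eq_one _ hdim (isQuotientMap_ghostMap Y)
      (fun _ _ h => ghostMap_eq Y h) bdry fun p => ?_
    have hb : (bdry p).path.holonomy b = 1 :=
      holonomy_eq_one_of_transport (ContinuousMap.id X) hdim IsQuotientMap.id
        (fun _ _ h => Or.inl h) (T := S.mapHom inl) (fun e => rfl) _
    rw [EdgePath.holonomy_gauge (h := fun v => (t v)⁻¹) (a := b) (fun e => by rw [inv_inv]), hb]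
    simp
  have hTX : ∀ (u v : Vertex X) (p : Path.Homotopic.Quotient (vertexPoint u) (vertexPoint v)),
      (T.comap (ghostMap Y)).toFun p = (t u)⁻¹ * inl (S.toFun p) * t v := by
    let d : X → K := Function.extend vertexPoint t 1
    have hd : ∀ v, d (vertexPoint v) = t v := fun v =>
      vertexPoint_injective.extend_apply t 1 v
    intro u v p
    have := (cellStructure hdim).gaugeRelated_of_edge (S.mapHom inl) (T.comap (ghostMap Y)) d
      (fun e => by
        have h0 : (cellStructure hdim).edge e 0 = vertexPoint (source e) := edgePoint_zero e
        have h1 : (cellStructure hdim).edge e 1 = vertexPoint (target e) := edgePoint_one e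
        rw [h0, h1, hd, hd]
        exact (T.comap_arc _ _ _ _).trans (hT e)) ⟨_, ⟨u, rfl⟩, rfl⟩ ⟨_, ⟨v, rfl⟩, rfl⟩ p
    refine this.trans ?_
    change (d (vertexPoint u))⁻¹ * _ * d (vertexPoint v) = _
    rw [hd, hd]
    rfl
  let loop : ∀ v ∈ Y, Path.Homotopic.Quotient (ghostPoint Y y) (ghostPoint Y y) := fun v hv =>
    Path.Homotopic.Quotient.cast (x := ghostPoint Y y) (y := ghostPoint Y v)
      ((c (vertexPoint v)).map (ghostMap Y)) rfl (ghostPoint_eq hy hv)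
  have hloop : ∀ {H : Type _} [Group H] (U : Transport (GhostQuotient Y) H) v (hv : v ∈ Y),
      U.toFun (loop v hv) = (U.comap (ghostMap Y)).toFun (c (vertexPoint v)) :=
    fun U v hv => U.map_cast _ _ _
  -- The inverse of the loop matches `β`, whose definition inverts the value `t v` of `T` on the
  -- loop.
  let α : K →* FundamentalGroup (GhostQuotient Y) (ghostPoint Y y) :=
    Monoid.Coprod.lift (ghostHom Y y) (FreeGroup.lift fun v =>
      (FundamentalGroup.fromPath (loop v.1 v.2.1))⁻¹)
  let β := T.toHom (ghostPoint Y y)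
  have hβ : ∀ p, β (FundamentalGroup.fromPath p) = (T.toFun p)⁻¹ := fun p => rfl
  have hαinl : ∀ g, α (inl g) = ghostHom Y y g := Monoid.Coprod.lift_apply_inl _ _
  have hαt : ∀ v (h : v ∈ Y ∧ v ≠ y), α (t v) = (FundamentalGroup.fromPath (loop v h.1))⁻¹ :=
    fun v h => by
      simp only [t, dif_pos h]
      exact (Monoid.Coprod.lift_apply_inr _ _ _).trans FreeGroup.lift_apply_of
  refine ⟨MonoidHom.toMulEquiv β α (MonoidHom.ext fun p => ?_) (Monoid.Coprod.hom_ext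
    (MonoidHom.ext fun p => ?_) (FreeGroup.ext_hom _ _ fun v => ?_))⟩
  -- For `α ∘ β = id`, the transports `T.mapHom α` and `S'` on `X / Y` are compared. They are
  -- related along the edges by `D`, which exists on the quotient because `w` and `α ∘ t` agree on
  -- `Y`.
  · let w : X → FundamentalGroup (GhostQuotient Y) (ghostPoint Y y) := fun x =>
      (S'.comap (ghostMap Y)).toFun (c x)
    have hD : ∀ v ∈ Y, (w (vertexPoint v))⁻¹ * α (t v) = 1 := fun v hv => by
      rw [inv_mul_eq_one]
      by_cases hvy : v = y
      · subst hvy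
        rw [hty, map_one]
        simp only [w, hc]
        exact Transport.map_refl _ _
      · rw [hαt v ⟨hv, hvy⟩, ← tautologicalTransport_apply_loop hc', hloop _ v hv]
    obtain ⟨D, hDv⟩ := exists_comp_ghostPoint_eq Y (fun v => (w (vertexPoint v))⁻¹ * α (t v))
      fun v hv v' hv' => by rw [hD v hv, hD v' hv']
    have hmem : ghostPoint Y y ∈ (ghostCellStructure Y hdim).verts := ⟨_, ⟨y, rfl⟩, rfl⟩
    have := (ghostCellStructure Y hdim).gaugeRelated_of_edge S' (T.mapHom α) D (fun e => by
      have h0 : (ghostCellStructure Y hdim).edge e 0 = ghostPoint Y (source e) :=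
        congrArg (ghostMap Y) (edgePoint_zero e)
      have h1 : (ghostCellStructure Y hdim).edge e 1 = ghostPoint Y (target e) :=
        congrArg (ghostMap Y) (edgePoint_one e)
      have hb : α (b e) = w (vertexPoint (source e)) *
          S'.arc ((ghostMap Y).comp (edgeMap e)) 0 1 * (w (vertexPoint (target e)))⁻¹ := by
        rw [← edgePoint_zero, ← edgePoint_one, ← S'.comap_arc]
        exact (hαinl _).trans (ghostHom_tautologicalTransport hc' (arcClass (edgeMap e) 0 1))
      rw [h0, h1, hDv, hDv]
      refine (congrArg α (hT e)).trans ?_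
      rw [map_mul, map_mul, map_inv, hb]
      change _ = _ * S'.arc ((ghostMap Y).comp (edgeMap e)) 0 1 * _
      group) hmem hmem (FundamentalGroup.toPath p)
    rw [hDv, hD y hy, inv_one, one_mul, mul_one, tautologicalTransport_apply_loop hc'] at this
    refine (map_inv α (T.toFun (FundamentalGroup.toPath p))).trans ?_
    exact (congrArg _ this).trans (inv_inv _)
  -- On loops of `X` at `y`, the gauge factors `t y` are trivial.
  · change β (α (inl p)) = inl p
    rw [hαinl]
    change (T.toFun ((FundamentalGroup.toPath p).map (ghostMap Y)))⁻¹ = _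
    refine (congrArg _ (hTX y y (FundamentalGroup.toPath p))).trans ?_
    rw [hty, inv_one, one_mul, mul_one, tautologicalTransport_apply_loop hc, map_inv, inv_inv]
  -- The chosen path to `v` has trivial class under `S`, so `T` takes exactly the value `t v` on its
  -- loop.
  · have hv : t v.1 = inr (.of v) := dif_pos v.2
    change β (α (inr (.of v))) = inr (.of v)
    rw [← hv, hαt v.1 v.2, map_inv, hβ, inv_inv, hloop _ v.1 v.2.1, hTX, hty,
      tautologicalTransport_apply_choice hc, inv_one, one_mul]
    exact (congrArg (· * t v.1) (map_one inl)).trans (one_mul _)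

end FundamentalGroup

/-! ### Homomorphisms out of the free product -/

section Coprod

/-- Homomorphisms from the free product of a group and a free group. -/
def coprodFreeGroupHomEquiv (K ι G : Type*) [Group K] [Group G] :
    (Monoid.Coprod K (FreeGroup ι) →* G) ≃ (K →* G) × (ι → G) :=
  Monoid.Coprod.liftEquiv.symm.trans (Equiv.prodCongr (Equiv.refl _) FreeGroup.lift.symm)

end Coprod

/-! ### Arbitrary base points and numbered generators -/

section Main

open TensorProduct

variable {X : Type*} [TopologicalSpace X] [CWComplex (Set.univ : Set X)] [T2Space X]
  [ConnectedSpace X]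

theorem nonempty_fundamentalGroup_mulEquiv_coprod
    (hdim : ∀ n : ℕ, 3 ≤ n → IsEmpty (RelCWComplex.cell (Set.univ : Set X) n))
    (bdry : ∀ p : Face X, BoundaryWord p) (Y : Finset (Vertex X)) {y : Vertex X}
    (hy : y ∈ (Y : Set (Vertex X))) (x : X) :
    Nonempty (FundamentalGroup (GhostQuotient (Y : Set (Vertex X))) (ghostPoint Y y) ≃*
      Monoid.Coprod (FundamentalGroup X x) (FreeGroup (Fin (Y.card - 1)))) := by
  classical
  obtain ⟨e⟩ := nonempty_fundamentalGroup_ghostQuotient_mulEquiv hdim bdry hy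
  have := pathConnectedSpace_of_vertex hdim y
  -- The ghost vertex `y` serves as the base point and contributes no generator, whence `Y.card -
  -- 1`.
  have f : {v // v ∈ (Y : Set (Vertex X)) ∧ v ≠ y} ≃ Fin (Y.card - 1) :=
    (Equiv.subtypeEquivRight fun v => by simp [and_comm]).trans
      ((Y.erase y).equivFinOfCardEq (Finset.card_erase_of_mem hy))
  exact ⟨e.trans ((FundamentalGroup.fundamentalGroupMulEquivOfPathConnected _ x).coprodCongr
    (FreeGroup.freeGroupCongr f))⟩

end Main

end QuantumDouble

end

/-! ### The main theorem -/

open Topology TensorProduct QuantumDouble in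
open Classical in
theorem mainTheorem4 {X : Type*} [TopologicalSpace X] [T2Space X] [ConnectedSpace X]
    [CWComplex (Set.univ : Set X)]
    (hdim : ∀ n : ℕ, 3 ≤ n → IsEmpty (RelCWComplex.cell (Set.univ : Set X) n))
    [Finite (Edge X)]
    (bdry : ∀ p : Face X, BoundaryWord p)
    {G : Type*} [Group G] [Finite G]
    (Y : Finset (Vertex X)) (y : Vertex X) (hy : y ∈ (Y : Set (Vertex X))) (x : X) :
    (∃ Ψ : ((FundamentalGroup (GhostQuotient (Y : Set (Vertex X))) (ghostPoint Y y) →* G) →₀ ℂ)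
          ≃ₗ[ℂ] codespace G bdry (Y : Set (Vertex X)),
        ∀ (φ : FundamentalGroup (GhostQuotient (Y : Set (Vertex X))) (ghostPoint Y y) →* G)
          (a : Configuration X G),
          (Ψ (Finsupp.single φ 1) : PhysicalSpace X G) a = if HasHolonomy hy φ a then 1 else 0) ∧
      Nonempty (FundamentalGroup (GhostQuotient (Y : Set (Vertex X))) (ghostPoint Y y) ≃*
        Monoid.Coprod (FundamentalGroup X x) (FreeGroup (Fin (Y.card - 1)))) ∧
      Nonempty (codespace G bdry (Y : Set (Vertex X)) ≃ₗ[ℂ]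
        ((FundamentalGroup X x →* G) →₀ ℂ) ⊗[ℂ] ((Fin (Y.card - 1) → G) →₀ ℂ)) := by
  have := pathConnectedSpace_of_vertex hdim y
  obtain ⟨Ψ, hΨ⟩ := exists_codespace_equiv hdim bdry (G := G) hy
  obtain ⟨e⟩ := nonempty_fundamentalGroup_mulEquiv_coprod hdim bdry Y hy x
  have f := (Finsupp.domLCongr (M := ℂ) (R := ℂ) (e.monoidHomCongrLeftEquiv.trans
    (coprodFreeGroupHomEquiv _ _ G))).trans (finsuppTensorFinsupp' ℂ _ _).symm
  exact ⟨⟨Ψ, hΨ⟩, ⟨e⟩, ⟨Ψ.symm.trans f⟩⟩
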